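/- For a nonnegative function $h\in L^\infty(0,1)$ and $k\ge 1$ let $$\mu_k(h)=\inf_{E_k}\ \sup_{0\ne u\in E_k}\ \frac{\int_0^1 (u')^2h\,dx}{\int_0^1u^2h\,dx},$$ the infimum being over all $k$-dimensional subspaces $E_k$ of the Sobolev space $H^1(0,1)$ with $\int_0^1uh\,dx=0$ for all $u\in E_k$. For a bounded, connected, open set $\Omega\subset\mathbb R^d$ with Lipschitz boundary, let $D(\Omega)$ be its diameter and let $$\mu_k(\Omega)=\inf_{E_k}\ \sup_{0\ne u\in E_k}\ \frac{\int_\Omega |\nabla u|^2dx}{\int_\Omega u^2dx}$$ be its $k$-th Neumann eigenvalue, the infimum being over all $k$-dimensional subspaces $E_k$ of $H^1(\Omega)$ with $\int_\Omega u\,dx=0$ for all $u\in E_k$. For $0<a<\frac12$ let $w_a$ be the first positive root of $$\tan\big(x(\tfrac12-a)\big)=1+\frac1{ax},$$ and define $$g_a(x)=\begin{cases}e^{2w_a(x-a)}&0\le x<a,\\ 1&a\le x\le 1-a,\\ e^{2w_a(1-x-a)}&1-a<x\le1.\end{cases}$$ Then: 1. for every $0<a<\frac12$ the first positive root $w_a$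 exists and $\mu_1(g_a)=w_a^2$; 2. $w_a\to+\infty$ as $a\to\frac12^-$; 3. $\mu_1(g_a)\to+\infty$ as $a\to\frac12^-$; 4. for every dimension $d\ge2$, $\ \sup D(\Omega)^2\mu_1(\Omega)=+\infty$, the supremum being over all bounded, connected, open sets $\Omega\subset\mathbb R^d$ with Lipschitz boundary. -/

import Mathlib

open MeasureTheory Filter Topology Set
open scoped ENNReal ContDiff NNReal

noncomputable section

/-- The Sobolev space `H¹(Ω)` of an open set `Ω`: the pairs `(u, ∇u)` where `u ∈ L²(Ω)` has the
weak gradient `∇u ∈ L²(Ω)`, i.e. `∫_Ω u ∂_v φ = - ∫_Ω ⟨∇u, v⟩ φ` for all `φ ∈ C_c^∞(Ω)` and all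
directions `v`. (On an open set the second component is determined by the first one.) -/
def sobolevH1 {E : Type*} [NormedAddCommGroup E] [InnerProductSpace ℝ E] [FiniteDimensional ℝ E]
    [MeasurableSpace E] [BorelSpace E] (Ω : Set E) :
    Submodule ℝ (Lp ℝ 2 (volume.restrict Ω) × Lp E 2 (volume.restrict Ω)) where
  carrier := {p | ∀ φ : E → ℝ, ContDiff ℝ ∞ φ → HasCompactSupport φ → tsupport φ ⊆ Ω → ∀ v : E,
    ∫ x in Ω, p.1 x * fderiv ℝ φ x v = - ∫ x in Ω, inner ℝ (p.2 x) v * φ x}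
  zero_mem' := by
    intro φ _ _ _ v
    have h1 : ∫ x in Ω, (0 : Lp ℝ 2 (volume.restrict Ω) × Lp E 2 (volume.restrict Ω)).1 x
        * fderiv ℝ φ x v = 0 := by
      rw [integral_eq_zero_of_ae]
      filter_upwards [Lp.coeFn_zero ℝ 2 (volume.restrict Ω)] with x hx
      simp only [Prod.fst_zero, hx, Pi.zero_apply, zero_mul]
    have h2 : ∫ x in Ω,
        inner ℝ ((0 : Lp ℝ 2 (volume.restrict Ω) × Lp E 2 (volume.restrict Ω)).2 x) v * φ x = 0 := by
      rw [integral_eq_zero_of_ae]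
      filter_upwards [Lp.coeFn_zero E 2 (volume.restrict Ω)] with x hx
      simp only [Prod.snd_zero, hx, Pi.zero_apply, inner_zero_left, zero_mul]
    rw [h1, h2, neg_zero]
  add_mem' := by
    intro p q hp hq φ h1 h2 h3 v
    have hφ : MemLp φ 2 (volume.restrict Ω) :=
      (h1.continuous.memLp_of_hasCompactSupport h2).restrict Ω
    have hdφ : MemLp (fun x => fderiv ℝ φ x v) 2 (volume.restrict Ω) := by
      refine (Continuous.memLp_of_hasCompactSupport ?_ ?_).restrict Ω
      · exact (h1.continuous_fderiv (by simp)).clm_apply continuous_const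
      · exact h2.fderiv_apply ℝ v
    have hL : ∀ r : Lp ℝ 2 (volume.restrict Ω),
        Integrable (fun x => r x * fderiv ℝ φ x v) (volume.restrict Ω) :=
      fun r => (Lp.memLp r).integrable_mul hdφ
    have hR : ∀ r : Lp E 2 (volume.restrict Ω),
        Integrable (fun x => inner ℝ (r x) v * φ x) (volume.restrict Ω) :=
      fun r => ((Lp.memLp r).inner_const v).integrable_mul hφ
    have e1 : ∫ x in Ω, (p + q).1 x * fderiv ℝ φ x v
        = ∫ x in Ω, (p.1 x * fderiv ℝ φ x v + q.1 x * fderiv ℝ φ x v) := by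
      apply integral_congr_ae
      filter_upwards [Lp.coeFn_add p.1 q.1] with x hx
      simp only [Prod.fst_add, hx, Pi.add_apply, add_mul]
    have e2 : ∫ x in Ω, inner ℝ ((p + q).2 x) v * φ x
        = ∫ x in Ω, (inner ℝ (p.2 x) v * φ x + inner ℝ (q.2 x) v * φ x) := by
      apply integral_congr_ae
      filter_upwards [Lp.coeFn_add p.2 q.2] with x hx
      simp only [Prod.snd_add, hx, Pi.add_apply, inner_add_left, add_mul]
    rw [e1, e2, integral_add (hL _) (hL _), integral_add (hR _) (hR _), hp φ h1 h2 h3 v,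
      hq φ h1 h2 h3 v]
    ring
  smul_mem' := by
    intro c p hp φ h1 h2 h3 v
    have e1 : ∫ x in Ω, (c • p).1 x * fderiv ℝ φ x v
        = ∫ x in Ω, c * (p.1 x * fderiv ℝ φ x v) := by
      apply integral_congr_ae
      filter_upwards [Lp.coeFn_smul c p.1] with x hx
      simp [hx, mul_assoc]
    have e2 : ∫ x in Ω, inner ℝ ((c • p).2 x) v * φ x
        = ∫ x in Ω, c * (inner ℝ (p.2 x) v * φ x) := by
      apply integral_congr_ae
      filter_upwards [Lp.coeFn_smul c p.2] with x hx
      simp [hx, mul_assoc, inner_smul_left]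
    rw [e1, e2, integral_const_mul, integral_const_mul, hp φ h1 h2 h3 v]
    ring

/-- The Rayleigh quotient `∫_Ω |∇u|² h / ∫_Ω u² h` of `(u, ∇u) ∈ H¹(Ω)` for a weight `h ≥ 0`. -/
def rayleighQuotient {E : Type*} [NormedAddCommGroup E] [InnerProductSpace ℝ E]
    [FiniteDimensional ℝ E] [MeasurableSpace E] [BorelSpace E] (Ω : Set E) (h : E → ℝ)
    (p : Lp ℝ 2 (volume.restrict Ω) × Lp E 2 (volume.restrict Ω)) : ℝ≥0∞ :=
  (∫⁻ x in Ω, ‖p.2 x‖ₑ ^ 2 * ENNReal.ofReal (h x)) /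
    (∫⁻ x in Ω, ‖p.1 x‖ₑ ^ 2 * ENNReal.ofReal (h x))

/-- The admissible spaces of the min-max principle: the `k`-dimensional subspaces of `H¹(Ω)` whose
elements `u` satisfy `∫_Ω u h = 0`. -/
def minMaxSpaces {E : Type*} [NormedAddCommGroup E] [InnerProductSpace ℝ E]
    [FiniteDimensional ℝ E] [MeasurableSpace E] [BorelSpace E] (k : ℕ) (Ω : Set E) (h : E → ℝ) :
    Set (Submodule ℝ (Lp ℝ 2 (volume.restrict Ω) × Lp E 2 (volume.restrict Ω))) :=
  {V | V ≤ sobolevH1 Ω ∧ FiniteDimensional ℝ V ∧ Module.finrank ℝ V = k ∧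
    ∀ p ∈ V, ∫ x in Ω, p.1 x * h x = 0}

/-- The min-max value `inf_V sup_{0 ≠ u ∈ V} ∫_Ω |∇u|² h / ∫_Ω u² h` over the `k`-dimensional
subspaces `V` of `H¹(Ω)` orthogonal to `h` in `L²(Ω)` (for a bounded open set `Ω` and a bounded
weight `h ≥ 0`). -/
def minMaxValue {E : Type*} [NormedAddCommGroup E] [InnerProductSpace ℝ E]
    [FiniteDimensional ℝ E] [MeasurableSpace E] [BorelSpace E] (k : ℕ) (Ω : Set E) (h : E → ℝ) :
    ℝ≥0∞ :=
  ⨅ V ∈ minMaxSpaces k Ω h, ⨆ p ∈ {p | p ∈ V ∧ p ≠ 0}, rayleighQuotient Ω h p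

/-- The relaxed Sturm-Liouville eigenvalue `μ_k(h)` of a weight `h` on the interval `(0,1)`. -/
def relaxedEigenvalue (k : ℕ) (h : ℝ → ℝ) : ℝ≥0∞ := minMaxValue k (Ioo (0 : ℝ) 1) h

/-- The Neumann eigenvalue `μ_k(Ω)` (`k ≥ 1`) of a domain `Ω ⊆ ℝᵈ`. -/
def neumannEigenvalue {d : ℕ} (k : ℕ) (Ω : Set (EuclideanSpace ℝ (Fin d))) : ℝ≥0∞ :=
  minMaxValue k Ω (fun _ => 1)

/-- `Ω` has Lipschitz boundary: near each boundary point, `Ω` is the set of points strictly above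
the graph of a Lipschitz function over the hyperplane orthogonal to some unit vector `e`
(`x - ⟨e, x⟩ e` is the projection of `x` to that hyperplane). -/
def HasLipschitzBoundary {d : ℕ} (Ω : Set (EuclideanSpace ℝ (Fin d))) : Prop :=
  ∀ p ∈ frontier Ω, ∃ U ∈ 𝓝 p, ∃ e : EuclideanSpace ℝ (Fin d), ‖e‖ = 1 ∧
    ∃ (K : ℝ≥0) (f : EuclideanSpace ℝ (Fin d) → ℝ), LipschitzWith K f ∧
      ∀ x ∈ U, x ∈ Ω ↔ f (x - (inner ℝ e x) • e) < inner ℝ e x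

/-- The bounded Lipschitz domains of `ℝᵈ`. -/
def boundedLipschitzDomains (d : ℕ) : Set (Set (EuclideanSpace ℝ (Fin d))) :=
  {Ω | IsOpen Ω ∧ IsConnected Ω ∧ Bornology.IsBounded Ω ∧ HasLipschitzBoundary Ω}

/-- The positive roots of `tan (x (1/2 - a)) = 1 + 1 / (a x)` (points where the tangent is
undefined are excluded). -/
def plateauRoots (a : ℝ) : Set ℝ :=
  {x | 0 < x ∧ Real.cos (x * (1 / 2 - a)) ≠ 0 ∧
    Real.tan (x * (1 / 2 - a)) = 1 + 1 / (a * x)}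

/-- The first positive root `w_a`. -/
def plateauRoot (a : ℝ) : ℝ := sInf (plateauRoots a)

/-- The exponential-plateau-exponential weight `g_a`. -/
def plateauWeight (a x : ℝ) : ℝ :=
  if x < a then Real.exp (2 * plateauRoot a * (x - a))
  else if x ≤ 1 - a then 1
  else Real.exp (2 * plateauRoot a * (1 - x - a))

end

/-!
**The weights `g_a`.** Let `w = w_a`. On the first branch of the tangent the left side of
`tan (x (1/2 - a)) = 1 + 1 / (a x)` increases while the right side decreases, so there is a first
root, with `π/4 < w (1/2 - a) < π/2` (`isLeast_plateauRoots`); the lower bound forces `w → ∞` as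
`a → 1/2`. The root equation says exactly that `sin (w (x - 1/2))` on the plateau can be continued
by multiples of `(1 + w x) e^{-w x}` and its reflection to a `C¹` function `u` with
`(g_a u')' = - w² g_a u` and `u' = 0` at `0` and `1`. It is odd about `1/2`, hence admissible, and
its Rayleigh quotient is `w²` (`relaxedEigenvalue_plateauWeight_le`).

For the lower bound, `u' > 0` on `(0, 1)` serves as the test function in Schur's test for the Hardy
operator `φ ↦ ∫_{1/2}^x φ`: it gives `∫ |f - f(1/2)|² g_a ≤ w⁻² ∫ |f'|² g_a` for smooth `f` with the
sharp constant (`lintegral_sq_mul_plateauWeight_le`). Replacing `f(1/2)` by the mean only decreases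
the left side.

**From smooth functions to `H¹`.** Both lower bounds are obtained from inequalities for smooth
functions on sets `K n` exhausting the domain, which are written with the double integral
`∬ |f x - f y|²` in place of the variance. An element of `H¹` is mollified; since the weights
satisfy `h x ≤ e^{M |x - y|} h y`, the weighted energy of the mollification on `K n` exceeds the
original energy by at most the factor `e^{M r}`, where `r` is the radius of the mollifier, and the
left sides pass to the limit by Fatou's lemma. Thus no density theorem up to the boundary is needed
(`inv_le_minMaxValue_one`).

**Domains.** In dimension `n + 1` take the spindle over `(-1, 1)` whose section at height `t` is a
cube of half side `κ⁻¹ e^{-κ|t|}`. Its diameter is at least `1`, and it is star-shaped with respect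
to a small ball because the profile decays at most exponentially; this implies that its boundary is
Lipschitz (`hasLipschitzBoundary_of_starConvex`). In the coordinates `(t, y)` with
`x = (t, κ⁻¹ e^{-κ|t|} y)`, Lebesgue measure becomes the product of `e^{-nκ|t|} dt` and Lebesgue
measure on a cube. On the `t`-factor Hardy's inequality from the center has the constant
`4 / (n κ)²`, because the exponential weight decays away from the center
(`lintegral_sq_mul_exp_le`); on the cube the Poincaré inequality for convex sets yields a factor
`κ⁻²` by scaling (`Convex.lintegral_lintegral_sub_sq_le`). Tensorization gives
`∬ |f x - f y|² ≤ C κ⁻² |Ω| ∫ |∇f|²` (`lintegral_lintegral_spindle_le`), that is, `μ₁ ≥ c κ²`, and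
`κ → ∞` makes `D² μ₁` unbounded.
-/

/-! ### Weighted Cauchy–Schwarz and Hardy inequalities -/

theorem sq_lintegral_mul_le {α : Type*} [MeasurableSpace α] (μ : Measure α) {f g : α → ℝ≥0∞}
    (hf : AEMeasurable f μ) (hg : AEMeasurable g μ) :
    (∫⁻ x, f x * g x ∂μ) ^ 2 ≤ (∫⁻ x, f x ^ 2 ∂μ) * ∫⁻ x, g x ^ 2 ∂μ := by
  have h := ENNReal.lintegral_mul_le_Lp_mul_Lq μ Real.HolderConjugate.two_two hf hg
  have h2 := pow_le_pow_left' h 2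
  simp only [Pi.mul_apply, ENNReal.rpow_two, mul_pow] at h2
  have key : ∀ x : ℝ≥0∞, (x ^ (1 / 2 : ℝ)) ^ 2 = x := by
    intro x
    rw [← ENNReal.rpow_natCast, ← ENNReal.rpow_mul]
    norm_num
  rwa [key, key] at h2

theorem sq_lintegral_le_lintegral_sq_div_mul {α : Type*} [MeasurableSpace α] (μ : Measure α)
    {f ψ : α → ℝ≥0∞} (hf : AEMeasurable f μ) (hψ : AEMeasurable ψ μ)
    (h0 : ∀ᵐ x ∂μ, ψ x ≠ 0) (h1 : ∀ᵐ x ∂μ, ψ x ≠ ⊤) :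
    (∫⁻ x, f x ∂μ) ^ 2 ≤ (∫⁻ x, f x ^ 2 / ψ x ∂μ) * ∫⁻ x, ψ x ∂μ := by
  have key : ∀ x : ℝ≥0∞, (x ^ (1 / 2 : ℝ)) ^ 2 = x := by
    intro x
    rw [← ENNReal.rpow_natCast, ← ENNReal.rpow_mul]
    norm_num
  have h : (∫⁻ x, f x / ψ x ^ (1 / 2 : ℝ) * ψ x ^ (1 / 2 : ℝ) ∂μ) ^ 2 ≤
      (∫⁻ x, (f x / ψ x ^ (1 / 2 : ℝ)) ^ 2 ∂μ) * ∫⁻ x, (ψ x ^ (1 / 2 : ℝ)) ^ 2 ∂μ :=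
    sq_lintegral_mul_le μ (hf.div (hψ.pow_const (1 / 2 : ℝ))) (hψ.pow_const (1 / 2 : ℝ))
  simp only [div_eq_mul_inv _ (_ ^ (1 / 2 : ℝ)), mul_pow, ← ENNReal.inv_pow, key] at h
  simp only [div_eq_mul_inv (_ ^ 2)]
  refine le_trans (le_of_eq ?_) h
  congr 1
  apply lintegral_congr_ae
  filter_upwards [h0, h1] with x hx hx'
  rw [mul_assoc, ENNReal.inv_mul_cancel, mul_one]
  · simp [hx, hx']
  · simp [hx, hx']

/-- Hardy's inequality for a weight `h` on an interval `I` around the base point `c`, by Schur's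
test: it is enough to find a density `ψ > 0` whose primitive `Φ` from `c` satisfies
`∫ Φ h ≤ C h(s) ψ(s)` over the points beyond `s`, as seen from `c`. -/
theorem lintegral_sq_mul_le_of_schur {I : Set ℝ} (hI : MeasurableSet I) {c : ℝ}
    (hc : ∀ t ∈ I, uIoc c t ⊆ I) {v G ψ Φ h : ℝ → ℝ≥0∞} {C : ℝ≥0∞} (hG : Measurable G)
    (hψ : Measurable ψ) (hΦm : Measurable Φ) (hh : Measurable h)
    (hv : ∀ t ∈ I, v t ≤ ∫⁻ s in uIoc c t, G s)
    (hΦ : ∀ t ∈ I, ∫⁻ s in uIoc c t, ψ s ≤ Φ t)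
    (hψ0 : ∀ s ∈ I, ψ s ≠ 0) (hψ1 : ∀ s ∈ I, ψ s ≠ ⊤)
    (hC : ∀ s ∈ I, ∫⁻ t in I ∩ {t | s ∈ uIoc c t}, Φ t * h t ≤ C * (h s * ψ s)) :
    ∫⁻ t in I, v t ^ 2 * h t ≤ C * ∫⁻ s in I, G s ^ 2 * h s := by
  have hR : MeasurableSet {p : ℝ × ℝ | p.2 ∈ uIoc c p.1} := by
    have m1 : Measurable fun p : ℝ × ℝ => min c p.1 := by fun_prop
    have m2 : Measurable fun p : ℝ × ℝ => max c p.1 := by fun_prop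
    exact (measurableSet_lt m1 measurable_snd).inter (measurableSet_le measurable_snd m2)
  have hRt : ∀ t, MeasurableSet (uIoc c t) := fun t => measurableSet_uIoc
  have hRs : ∀ s, MeasurableSet {t | s ∈ uIoc c t} := fun s =>
    (measurable_id.prodMk measurable_const) hR
  have hint : ∀ (F : ℝ → ℝ≥0∞) (t : ℝ), t ∈ I → ∫⁻ s in uIoc c t, F s =
      ∫⁻ s in I, {p : ℝ × ℝ | p.2 ∈ uIoc c p.1}.indicator (fun p => F p.2) (t, s) := by
    intro F t ht
    rw [← inter_eq_self_of_subset_left (hc t ht), ← Measure.restrict_restrict (hRt t),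
      ← lintegral_indicator (hRt t)]
    rfl
  have hae : ∀ (P : ℝ → Prop) (t : ℝ), t ∈ I → (∀ s ∈ I, P s) →
      ∀ᵐ s ∂(volume.restrict (uIoc c t)), P s := fun P t ht hP =>
    (ae_restrict_mem (hRt t)).mono fun s hs => hP s (hc t ht hs)
  have hm : Measurable fun p : ℝ × ℝ =>
      {p : ℝ × ℝ | p.2 ∈ uIoc c p.1}.indicator (fun p => G p.2 ^ 2 / ψ p.2 * (Φ p.1 * h p.1)) p :=
    Measurable.indicator (by fun_prop) hR
  -- Cauchy–Schwarz with the density `ψ`, then Tonelli's theorem on `{(t, s) | s ∈ uIoc c t}`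
  calc ∫⁻ t in I, v t ^ 2 * h t
      ≤ ∫⁻ t in I, ∫⁻ s in I, {p : ℝ × ℝ | p.2 ∈ uIoc c p.1}.indicator
          (fun p => G p.2 ^ 2 / ψ p.2 * (Φ p.1 * h p.1)) (t, s) := by
        refine setLIntegral_mono' hI fun t ht => ?_
        have e : ∫⁻ s in I, {p : ℝ × ℝ | p.2 ∈ uIoc c p.1}.indicator
            (fun p => G p.2 ^ 2 / ψ p.2 * (Φ p.1 * h p.1)) (t, s)
            = (∫⁻ s in uIoc c t, G s ^ 2 / ψ s) * (Φ t * h t) := by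
          rw [hint _ t ht, ← lintegral_mul_const _
            (by exact (Measurable.indicator (by fun_prop) hR).comp measurable_prodMk_left)]
          congr 1 with s
          simp only [indicator]
          split_ifs <;> simp
        rw [e, ← mul_assoc]
        gcongr
        calc v t ^ 2 ≤ (∫⁻ s in uIoc c t, G s) ^ 2 := by gcongr; exact hv t ht
          _ ≤ (∫⁻ s in uIoc c t, G s ^ 2 / ψ s) * ∫⁻ s in uIoc c t, ψ s :=
            sq_lintegral_le_lintegral_sq_div_mul _ hG.aemeasurable hψ.aemeasurable
              (hae _ t ht hψ0) (hae _ t ht hψ1)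
          _ ≤ _ := by gcongr; exact hΦ t ht
    _ = ∫⁻ s in I, ∫⁻ t in I, {p : ℝ × ℝ | p.2 ∈ uIoc c p.1}.indicator
          (fun p => G p.2 ^ 2 / ψ p.2 * (Φ p.1 * h p.1)) (t, s) :=
        lintegral_lintegral_swap hm.aemeasurable
    _ ≤ ∫⁻ s in I, C * (G s ^ 2 * h s) := by
        refine setLIntegral_mono' hI fun s hs => ?_
        have e : ∫⁻ t in I, {p : ℝ × ℝ | p.2 ∈ uIoc c p.1}.indicator
            (fun p => G p.2 ^ 2 / ψ p.2 * (Φ p.1 * h p.1)) (t, s)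
            = G s ^ 2 / ψ s * ∫⁻ t in I ∩ {t | s ∈ uIoc c t}, Φ t * h t := by
          rw [inter_comm, ← Measure.restrict_restrict (hRs s), ← lintegral_indicator (hRs s),
            ← lintegral_const_mul _ (Measurable.indicator (by fun_prop) (hRs s))]
          congr 1 with t
          by_cases hst : s ∈ uIoc c t <;> simp [indicator, hst]
        rw [e]
        calc G s ^ 2 / ψ s * ∫⁻ t in I ∩ {t | s ∈ uIoc c t}, Φ t * h t
            ≤ G s ^ 2 / ψ s * (C * (h s * ψ s)) := by gcongr; exact hC s hs
          _ = C * (G s ^ 2 * h s) * (ψ s / ψ s) := by simp only [div_eq_mul_inv]; ring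
          _ = C * (G s ^ 2 * h s) := by
            rw [ENNReal.div_self (hψ0 s hs) (hψ1 s hs), mul_one]
    _ = C * ∫⁻ s in I, G s ^ 2 * h s := lintegral_const_mul _ (by fun_prop)

theorem enorm_sub_le_lintegral_enorm_deriv {v v' : ℝ → ℝ} {N : Set ℝ} (hN : N.Countable)
    (hv : Continuous v) (hd : ∀ x ∉ N, HasDerivAt v (v' x) x) (hm : Measurable v') (c t : ℝ) :
    ‖v t - v c‖ₑ ≤ ∫⁻ s in uIoc c t, ‖v' s‖ₑ := by
  by_cases hfin : ∫⁻ s in uIoc c t, ‖v' s‖ₑ = ⊤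
  · simp [hfin]
  have hint : IntervalIntegrable v' volume c t := by
    rw [intervalIntegrable_iff]
    exact ⟨hm.aestronglyMeasurable, lt_top_iff_ne_top.2 hfin⟩
  have h := integral_eq_of_hasDerivAt_off_countable v v' hN hv.continuousOn
    (fun x hx => hd x hx.2) hint
  rw [← h, ← enorm_norm, intervalIntegral.norm_intervalIntegral_eq, enorm_norm]
  exact enorm_integral_le_lintegral_enorm _

/-! ### The variance as a double integral -/

theorem enorm_sq_eq_ofReal (r : ℝ) : ‖r‖ₑ ^ 2 = ENNReal.ofReal (r ^ 2) := by
  rw [Real.enorm_eq_ofReal_abs, ← ENNReal.ofReal_pow (abs_nonneg _), sq_abs]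

theorem lintegral_lintegral_enorm_sub_sq {α : Type*} [MeasurableSpace α] {ν : Measure α}
    [IsFiniteMeasure ν] {f : α → ℝ} (hf : MemLp f 2 ν) :
    ∫⁻ x, ∫⁻ y, ‖f x - f y‖ₑ ^ 2 ∂ν ∂ν =
      ENNReal.ofReal (2 * ν.real univ * ∫ x, f x ^ 2 ∂ν - 2 * (∫ x, f x ∂ν) ^ 2) := by
  have hf1 : Integrable f ν := hf.integrable (by norm_num)
  have hf2 : Integrable (fun x => f x ^ 2) ν := hf.integrable_sq
  have e1 : ∀ x, (∫ y, (f x - f y) ^ 2 ∂ν) =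
      f x ^ 2 * ν.real univ - f x * (2 * ∫ y, f y ∂ν) + ∫ y, f y ^ 2 ∂ν := by
    intro x
    have : ∀ y, (f x - f y) ^ 2 = f x ^ 2 - (2 * f x) * f y + f y ^ 2 := fun y => by ring
    simp only [this]
    have j : Integrable (fun y => f x ^ 2 - (2 * f x) * f y) ν :=
      (integrable_const _).sub (hf1.const_mul _)
    rw [integral_add j hf2, integral_sub (integrable_const _) (hf1.const_mul _), integral_const_mul, integral_const,
      smul_eq_mul]
    ring
  have e2 : ∀ x, ∫⁻ y, ‖f x - f y‖ₑ ^ 2 ∂ν = ENNReal.ofReal (∫ y, (f x - f y) ^ 2 ∂ν) := by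
    intro x
    simp only [enorm_sq_eq_ofReal]
    rw [ofReal_integral_eq_lintegral_ofReal]
    · exact ((memLp_const (f x)).sub hf).integrable_sq
    · exact ae_of_all _ fun y => sq_nonneg _
  have i1 : Integrable (fun x => f x ^ 2 * ν.real univ) ν := hf2.mul_const _
  have i2 : Integrable (fun x => f x * (2 * ∫ y, f y ∂ν)) ν := hf1.mul_const _
  have i3 : Integrable (fun x => f x ^ 2 * ν.real univ - f x * (2 * ∫ y, f y ∂ν)) ν := i1.sub i2
  simp only [e2]
  rw [← ofReal_integral_eq_lintegral_ofReal]
  · simp only [e1]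
    rw [integral_add i3 (integrable_const _), integral_sub i1 i2, integral_mul_const,
      integral_mul_const, integral_const, smul_eq_mul]
    congr 1
    ring
  · simp only [e1]
    exact i3.add (integrable_const _)
  · exact ae_of_all _ fun x => integral_nonneg fun y => sq_nonneg _

theorem two_mul_measure_univ_mul_lintegral_enorm_sq {α : Type*} [MeasurableSpace α]
    {ν : Measure α} [IsFiniteMeasure ν] {f : α → ℝ} (hf : MemLp f 2 ν) :
    2 * ν univ * ∫⁻ x, ‖f x‖ₑ ^ 2 ∂ν = ENNReal.ofReal (2 * ν.real univ * ∫ x, f x ^ 2 ∂ν) := by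
  simp only [enorm_sq_eq_ofReal]
  rw [ENNReal.ofReal_mul (by positivity), ENNReal.ofReal_mul (by positivity),
    ofReal_integral_eq_lintegral_ofReal hf.integrable_sq (ae_of_all _ fun x => sq_nonneg _)]
  simp

theorem lintegral_lintegral_enorm_sub_sq_le {α : Type*} [MeasurableSpace α] {ν : Measure α}
    [IsFiniteMeasure ν] {f : α → ℝ} (hf : MemLp f 2 ν) (c : ℝ) :
    ∫⁻ x, ∫⁻ y, ‖f x - f y‖ₑ ^ 2 ∂ν ∂ν ≤ 2 * ν univ * ∫⁻ x, ‖f x - c‖ₑ ^ 2 ∂ν := by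
  have hg : MemLp (fun x => f x - c) 2 ν := hf.sub (memLp_const c)
  rw [two_mul_measure_univ_mul_lintegral_enorm_sq hg]
  have h := lintegral_lintegral_enorm_sub_sq hg
  simp only [sub_sub_sub_cancel_right] at h
  rw [h]
  apply ENNReal.ofReal_le_ofReal
  nlinarith [sq_nonneg (∫ x, (f x - c) ∂ν)]

theorem lintegral_lintegral_enorm_sub_sq_of_integral_eq_zero {α : Type*} [MeasurableSpace α]
    {ν : Measure α} [IsFiniteMeasure ν] {f : α → ℝ} (hf : MemLp f 2 ν) (h0 : ∫ x, f x ∂ν = 0) :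
    ∫⁻ x, ∫⁻ y, ‖f x - f y‖ₑ ^ 2 ∂ν ∂ν = 2 * ν univ * ∫⁻ x, ‖f x‖ₑ ^ 2 ∂ν := by
  rw [two_mul_measure_univ_mul_lintegral_enorm_sq hf, lintegral_lintegral_enorm_sub_sq hf, h0]
  simp

theorem enorm_sub_sq_le_two_mul_add (a b c : ℝ) :
    ‖a - b‖ₑ ^ 2 ≤ 2 * ‖a - c‖ₑ ^ 2 + 2 * ‖c - b‖ₑ ^ 2 := by
  simp only [enorm_sq_eq_ofReal]
  rw [show (2 : ℝ≥0∞) = ENNReal.ofReal 2 by simp, ← ENNReal.ofReal_mul (by norm_num),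
    ← ENNReal.ofReal_mul (by norm_num), ← ENNReal.ofReal_add (by positivity) (by positivity)]
  apply ENNReal.ofReal_le_ofReal
  nlinarith [sq_nonneg (a - c - (c - b))]

/-- The variance on a product is controlled by the variances on the factors: go from `(t, η)` to
`(t', η')` through `(t', η)`. -/
theorem lintegral_lintegral_prod_enorm_sub_sq_le {X Y : Type*} [MeasurableSpace X]
    [MeasurableSpace Y] (ν₁ : Measure X) (ν₂ : Measure Y) [SFinite ν₁] [SFinite ν₂]
    {g : X × Y → ℝ} (hg : Measurable g) :
    ∫⁻ p, ∫⁻ q, ‖g p - g q‖ₑ ^ 2 ∂(ν₁.prod ν₂) ∂(ν₁.prod ν₂) ≤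
      2 * ν₂ univ * (∫⁻ y, ∫⁻ t, ∫⁻ t', ‖g (t, y) - g (t', y)‖ₑ ^ 2 ∂ν₁ ∂ν₁ ∂ν₂) +
      2 * ν₁ univ * (∫⁻ t, ∫⁻ y, ∫⁻ y', ‖g (t, y) - g (t, y')‖ₑ ^ 2 ∂ν₂ ∂ν₂ ∂ν₁) := by
  have m1 : Measurable fun z : (X × Y) × (X × Y) => ‖g z.1 - g z.2‖ₑ ^ 2 := by fun_prop
  calc ∫⁻ p, ∫⁻ q, ‖g p - g q‖ₑ ^ 2 ∂(ν₁.prod ν₂) ∂(ν₁.prod ν₂)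
      = ∫⁻ y, ∫⁻ t, ∫⁻ t', ∫⁻ y', ‖g (t, y) - g (t', y')‖ₑ ^ 2 ∂ν₂ ∂ν₁ ∂ν₁ ∂ν₂ := by
        rw [lintegral_prod_symm' _ m1.lintegral_prod_right']
        congr 1 with y
        congr 1 with t
        rw [lintegral_prod _ (by fun_prop)]
    _ ≤ ∫⁻ y, ∫⁻ t, ∫⁻ t', (2 * ν₂ univ * ‖g (t, y) - g (t', y)‖ₑ ^ 2 +
          2 * ∫⁻ y', ‖g (t', y) - g (t', y')‖ₑ ^ 2 ∂ν₂) ∂ν₁ ∂ν₁ ∂ν₂ := by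
        gcongr with y t t'
        calc ∫⁻ y', ‖g (t, y) - g (t', y')‖ₑ ^ 2 ∂ν₂
            ≤ ∫⁻ y', (2 * ‖g (t, y) - g (t', y)‖ₑ ^ 2 + 2 * ‖g (t', y) - g (t', y')‖ₑ ^ 2) ∂ν₂ :=
              lintegral_mono fun y' => enorm_sub_sq_le_two_mul_add _ _ _
          _ = _ := by
              rw [lintegral_add_left measurable_const, lintegral_const, lintegral_const_mul]
              · ring
              · fun_prop
    _ = _ := by
        have m2 : Measurable fun z : (X × Y) × Y => ‖g z.1 - g (z.1.1, z.2)‖ₑ ^ 2 := by fun_prop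
        have m3 : Measurable fun z : X × Y => ∫⁻ y', ‖g z - g (z.1, y')‖ₑ ^ 2 ∂ν₂ :=
          m2.lintegral_prod_right'
        have m5 : Measurable fun z : (Y × X) × X => ‖g (z.1.2, z.1.1) - g (z.2, z.1.1)‖ₑ ^ 2 := by
          fun_prop
        have m6 : Measurable fun z : Y × X => ∫⁻ t', ‖g (z.2, z.1) - g (t', z.1)‖ₑ ^ 2 ∂ν₁ :=
          m5.lintegral_prod_right'
        have e1 : ∀ y t, ∫⁻ t', (2 * ν₂ univ * ‖g (t, y) - g (t', y)‖ₑ ^ 2 +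
            2 * ∫⁻ y', ‖g (t', y) - g (t', y')‖ₑ ^ 2 ∂ν₂) ∂ν₁ =
            2 * ν₂ univ * ∫⁻ t', ‖g (t, y) - g (t', y)‖ₑ ^ 2 ∂ν₁ +
            2 * ∫⁻ t', ∫⁻ y', ‖g (t', y) - g (t', y')‖ₑ ^ 2 ∂ν₂ ∂ν₁ := by
          intro y t
          rw [lintegral_add_left (by fun_prop), lintegral_const_mul _ (by fun_prop),
            lintegral_const_mul _ (by exact m3.comp measurable_prodMk_right)]
        have m10 : ∀ y, Measurable fun t => ∫⁻ t', ‖g (t, y) - g (t', y)‖ₑ ^ 2 ∂ν₁ := by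
          intro y
          have m : Measurable fun z : X × X => ‖g (z.1, y) - g (z.2, y)‖ₑ ^ 2 := by fun_prop
          exact m.lintegral_prod_right'
        have e2 : ∀ y, ∫⁻ t, (2 * ν₂ univ * ∫⁻ t', ‖g (t, y) - g (t', y)‖ₑ ^ 2 ∂ν₁ +
            2 * ∫⁻ t', ∫⁻ y', ‖g (t', y) - g (t', y')‖ₑ ^ 2 ∂ν₂ ∂ν₁) ∂ν₁ =
            2 * ν₂ univ * ∫⁻ t, ∫⁻ t', ‖g (t, y) - g (t', y)‖ₑ ^ 2 ∂ν₁ ∂ν₁ +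
            2 * ν₁ univ * ∫⁻ t', ∫⁻ y', ‖g (t', y) - g (t', y')‖ₑ ^ 2 ∂ν₂ ∂ν₁ := by
          intro y
          rw [lintegral_add_right _ measurable_const, lintegral_const,
            lintegral_const_mul _ (m10 y)]
          ring
        have m7 : Measurable fun y =>
            2 * ν₂ univ * ∫⁻ t, ∫⁻ t', ‖g (t, y) - g (t', y)‖ₑ ^ 2 ∂ν₁ ∂ν₁ :=
          measurable_const.mul m6.lintegral_prod_right'
        have m8 : Measurable fun y =>
            ∫⁻ t', ∫⁻ y', ‖g (t', y) - g (t', y')‖ₑ ^ 2 ∂ν₂ ∂ν₁ := m3.lintegral_prod_left'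
        have m9 : Measurable fun y => ∫⁻ t, ∫⁻ t', ‖g (t, y) - g (t', y)‖ₑ ^ 2 ∂ν₁ ∂ν₁ :=
          m6.lintegral_prod_right'
        have m4 : AEMeasurable (Function.uncurry fun (y : Y) (t : X) =>
            ∫⁻ y', ‖g (t, y) - g (t, y')‖ₑ ^ 2 ∂ν₂) (ν₂.prod ν₁) :=
          (m3.comp measurable_swap).aemeasurable
        rw [lintegral_congr fun y => (lintegral_congr fun t => e1 y t).trans (e2 y),
          lintegral_add_left m7, lintegral_const_mul _ m9, lintegral_const_mul _ m8,
          lintegral_lintegral_swap m4]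

/-! ### Mollification of weakly differentiable functions -/

section Mollification

variable {E : Type*} [NormedAddCommGroup E] [InnerProductSpace ℝ E] [FiniteDimensional ℝ E]
  [MeasurableSpace E] [BorelSpace E]

/-- The convolution of `u`, extended by zero outside `Ω`, with the normalized bump function `φ`. -/
noncomputable def mollify (Ω : Set E) (φ : ContDiffBump (0 : E)) (u : E → ℝ) : E → ℝ :=
  MeasureTheory.convolution (φ.normed volume) (Ω.indicator u) (ContinuousLinearMap.lsmul ℝ ℝ) volume

theorem contDiff_mollify {Ω : Set E} (φ : ContDiffBump (0 : E)) {u : E → ℝ}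
    (hu : LocallyIntegrable (Ω.indicator u) volume) : ContDiff ℝ ∞ (mollify Ω φ u) :=
  φ.hasCompactSupport_normed.contDiff_convolution_left _ φ.contDiff_normed hu

theorem lintegral_normed_sub_eq_one (φ : ContDiffBump (0 : E)) (x : E) :
    ∫⁻ y, ENNReal.ofReal (φ.normed volume (x - y)) = 1 := by
  rw [← ofReal_integral_eq_lintegral_ofReal (φ.integrable_normed.comp_sub_left x)
    (ae_of_all _ fun y => φ.nonneg_normed _), integral_sub_left_eq_self, φ.integral_normed,
    ENNReal.ofReal_one]

/-- The gradient of the mollification is the mollification of the weak gradient, at points whose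
distance to the complement of `Ω` exceeds the mollification radius. -/
theorem fderiv_mollify_apply {Ω : Set E} (hΩ : MeasurableSet Ω) (φ : ContDiffBump (0 : E))
    {p : Lp ℝ 2 (volume.restrict Ω) × Lp E 2 (volume.restrict Ω)} (hp : p ∈ sobolevH1 Ω)
    (hu : LocallyIntegrable (Ω.indicator p.1) volume) {x : E}
    (hx : Metric.closedBall x φ.rOut ⊆ Ω) (v : E) :
    fderiv ℝ (mollify Ω φ p.1) x v = ∫ y in Ω, inner ℝ (p.2 y) v * φ.normed volume (x - y) := by
  set ρ := φ.normed volume with hρ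
  have hd : ContDiff ℝ ∞ ρ := φ.contDiff_normed
  have hd1 : ContDiff ℝ 1 ρ := φ.contDiff_normed
  have hc : HasCompactSupport ρ := φ.hasCompactSupport_normed
  have h1 := hc.hasFDerivAt_convolution_left (ContinuousLinearMap.lsmul ℝ ℝ) hd1 hu x
  -- the translate `y ↦ ρ (x - y)` is a test function
  have hψd : ContDiff ℝ ∞ fun y => ρ (x - y) := hd.comp (contDiff_const.sub contDiff_id)
  have hsupp : tsupport (fun y => ρ (x - y)) ⊆ Metric.closedBall x φ.rOut := by
    refine closure_minimal (fun y hy => ?_) Metric.isClosed_closedBall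
    have : x - y ∈ Function.support ρ := hy
    rw [hρ, φ.support_normed_eq, mem_ball_zero_iff, ← dist_eq_norm] at this
    rw [Metric.mem_closedBall, dist_comm]
    exact this.le
  have hψc : HasCompactSupport fun y => ρ (x - y) :=
    (isCompact_closedBall x φ.rOut).of_isClosed_subset (isClosed_tsupport _) hsupp
  have h2 := hp _ hψd hψc (hsupp.trans hx) v
  have hfd : ∀ y, fderiv ℝ (fun y => ρ (x - y)) y v = - fderiv ℝ ρ (x - y) v := by
    intro y
    have := ((hd1.differentiable one_ne_zero) (x - y)).hasFDerivAt.comp y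
      ((hasFDerivAt_const x y).sub (hasFDerivAt_id y))
    have h3 : fderiv ℝ (fun y => ρ (x - y)) y = _ := this.fderiv
    rw [h3]
    simp
  have hex := (hc.fderiv ℝ).convolutionExists_left
    ((ContinuousLinearMap.lsmul ℝ ℝ).precompL E) (hd1.continuous_fderiv one_ne_zero) hu x
  rw [show fderiv ℝ (mollify Ω φ p.1) x = _ from h1.fderiv, convolution_def,
    ContinuousLinearMap.integral_apply hex, ← integral_sub_left_eq_self _ volume x,
    ← neg_eq_iff_eq_neg.2 h2, ← integral_neg, ← integral_indicator hΩ]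
  congr 1 with y
  by_cases hy : y ∈ Ω <;> simp [hy, hfd, mul_comm]

theorem enorm_fderiv_mollify_le {Ω : Set E} (hΩ : MeasurableSet Ω) (φ : ContDiffBump (0 : E))
    {p : Lp ℝ 2 (volume.restrict Ω) × Lp E 2 (volume.restrict Ω)} (hp : p ∈ sobolevH1 Ω)
    (hu : LocallyIntegrable (Ω.indicator p.1) volume) {x : E}
    (hx : Metric.closedBall x φ.rOut ⊆ Ω) :
    ‖fderiv ℝ (mollify Ω φ p.1) x‖ₑ ≤
      ∫⁻ y in Ω, ‖p.2 y‖ₑ * ENNReal.ofReal (φ.normed volume (x - y)) := by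
  have hnn : ∀ y, 0 ≤ φ.normed volume (x - y) := fun y => φ.nonneg_normed _
  have hρ : MemLp (fun y => φ.normed volume (x - y)) 2 (volume.restrict Ω) := by
    refine (Continuous.memLp_of_hasCompactSupport ?_ ?_).restrict Ω
    · exact φ.continuous_normed.comp (continuous_const.sub continuous_id)
    · exact φ.hasCompactSupport_normed.comp_homeomorph (Homeomorph.subLeft x)
  have hint : Integrable (fun y => ‖p.2 y‖ * φ.normed volume (x - y)) (volume.restrict Ω) :=
    (Lp.memLp p.2).norm.integrable_mul hρ
  have h0 : 0 ≤ ∫ y in Ω, ‖p.2 y‖ * φ.normed volume (x - y) :=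
    integral_nonneg fun y => mul_nonneg (norm_nonneg _) (hnn y)
  have hle : ‖fderiv ℝ (mollify Ω φ p.1) x‖ ≤ ∫ y in Ω, ‖p.2 y‖ * φ.normed volume (x - y) := by
    refine ContinuousLinearMap.opNorm_le_bound _ h0 fun v => ?_
    rw [fderiv_mollify_apply hΩ φ hp hu hx, ← integral_mul_const]
    refine norm_integral_le_of_norm_le (hint.mul_const _) (ae_of_all _ fun y => ?_)
    rw [norm_mul, Real.norm_of_nonneg (hnn y), mul_right_comm]
    gcongr
    · exact hnn y
    · exact norm_inner_le_norm _ _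
  rw [← ofReal_norm]
  refine (ENNReal.ofReal_le_ofReal hle).trans (le_of_eq ?_)
  rw [ofReal_integral_eq_lintegral_ofReal hint
    (ae_of_all _ fun y => mul_nonneg (norm_nonneg _) (hnn y))]
  congr 1 with y
  rw [ENNReal.ofReal_mul (norm_nonneg _), ofReal_norm]

/-- Mollification at scale `r` increases the weighted Dirichlet energy by the factor
`exp (M r)` at most, if `log h` is `M`-Lipschitz: Jensen's inequality and Tonelli's theorem. -/
theorem lintegral_enorm_fderiv_mollify_sq_le {Ω K : Set E} (hΩ : MeasurableSet Ω)
    (φ : ContDiffBump (0 : E))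
    {p : Lp ℝ 2 (volume.restrict Ω) × Lp E 2 (volume.restrict Ω)} (hp : p ∈ sobolevH1 Ω)
    (hu : LocallyIntegrable (Ω.indicator p.1) volume) (hK : MeasurableSet K)
    (hKΩ : ∀ x ∈ K, Metric.closedBall x φ.rOut ⊆ Ω) {h : E → ℝ} {M : ℝ} (hM : 0 ≤ M)
    (hm : Measurable h) (h0 : ∀ x, 0 ≤ h x)
    (hlog : ∀ x y, h x ≤ Real.exp (M * dist x y) * h y) :
    ∫⁻ x in K, ‖fderiv ℝ (mollify Ω φ p.1) x‖ₑ ^ 2 * ENNReal.ofReal (h x) ≤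
      ENNReal.ofReal (Real.exp (M * φ.rOut)) *
        ∫⁻ y in Ω, ‖p.2 y‖ₑ ^ 2 * ENNReal.ofReal (h y) := by
  have hcont : Continuous (φ.normed volume : E → ℝ) := φ.continuous_normed
  have hG : Measurable p.2 := (Lp.stronglyMeasurable p.2).measurable
  have hmeas : Measurable fun z : E × E =>
      ‖p.2 z.2‖ₑ ^ 2 * (ENNReal.ofReal (φ.normed volume (z.1 - z.2)) * ENNReal.ofReal (h z.1)) := by
    have : Measurable fun z : E × E => φ.normed volume (z.1 - z.2) :=
      (hcont.comp (continuous_fst.sub continuous_snd)).measurable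
    fun_prop
  have hsqrt : ∀ x y, ENNReal.ofReal √(φ.normed volume (x - y)) ^ 2 =
      ENNReal.ofReal (φ.normed volume (x - y)) := fun x y => by
    rw [← ENNReal.ofReal_pow (Real.sqrt_nonneg _), Real.sq_sqrt (φ.nonneg_normed _)]
  -- Jensen's inequality is Cauchy–Schwarz for the square root of the kernel, whose mass on `Ω` is
  -- at most one
  calc ∫⁻ x in K, ‖fderiv ℝ (mollify Ω φ p.1) x‖ₑ ^ 2 * ENNReal.ofReal (h x)
      ≤ ∫⁻ x in K, ∫⁻ y in Ω, ‖p.2 y‖ₑ ^ 2 *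
          (ENNReal.ofReal (φ.normed volume (x - y)) * ENNReal.ofReal (h x)) := by
        refine setLIntegral_mono' hK fun x hx => ?_
        have mρ : Measurable fun y => φ.normed volume (x - y) :=
          (hcont.comp (continuous_const.sub continuous_id)).measurable
        simp only [← mul_assoc]
        rw [lintegral_mul_const _ (by fun_prop)]
        gcongr
        calc ‖fderiv ℝ (mollify Ω φ p.1) x‖ₑ ^ 2
            ≤ (∫⁻ y in Ω, (‖p.2 y‖ₑ * ENNReal.ofReal √(φ.normed volume (x - y))) *
                ENNReal.ofReal √(φ.normed volume (x - y))) ^ 2 := by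
              gcongr
              refine (enorm_fderiv_mollify_le hΩ φ hp hu (hKΩ x hx)).trans (le_of_eq ?_)
              congr 1 with y
              rw [mul_assoc, ← sq, hsqrt]
          _ ≤ (∫⁻ y in Ω, (‖p.2 y‖ₑ * ENNReal.ofReal √(φ.normed volume (x - y))) ^ 2) *
                ∫⁻ y in Ω, ENNReal.ofReal √(φ.normed volume (x - y)) ^ 2 :=
              sq_lintegral_mul_le _ (by fun_prop) (by fun_prop)
          _ ≤ (∫⁻ y in Ω, ‖p.2 y‖ₑ ^ 2 * ENNReal.ofReal (φ.normed volume (x - y))) * 1 := by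
              simp only [mul_pow, hsqrt]
              gcongr
              rw [← lintegral_normed_sub_eq_one φ x]
              exact setLIntegral_le_lintegral _ _
          _ = _ := mul_one _
    _ = ∫⁻ y in Ω, ∫⁻ x in K, ‖p.2 y‖ₑ ^ 2 *
          (ENNReal.ofReal (φ.normed volume (x - y)) * ENNReal.ofReal (h x)) :=
        lintegral_lintegral_swap hmeas.aemeasurable
    _ ≤ ∫⁻ y in Ω, ENNReal.ofReal (Real.exp (M * φ.rOut)) *
          (‖p.2 y‖ₑ ^ 2 * ENNReal.ofReal (h y)) := by
        refine lintegral_mono fun y => ?_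
        have mρ : Measurable fun x => φ.normed volume (x - y) :=
          (hcont.comp (continuous_id.sub continuous_const)).measurable
        rw [lintegral_const_mul _ (by fun_prop), mul_left_comm]
        gcongr
        calc ∫⁻ x in K, ENNReal.ofReal (φ.normed volume (x - y)) * ENNReal.ofReal (h x)
            ≤ ∫⁻ x, ENNReal.ofReal (φ.normed volume (x - y)) *
                (ENNReal.ofReal (Real.exp (M * φ.rOut)) * ENNReal.ofReal (h y)) := by
              refine (setLIntegral_le_lintegral _ _).trans (lintegral_mono fun x => ?_)
              by_cases hxy : φ.normed volume (x - y) = 0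
              · simp [hxy]
              · have hlt : x - y ∈ Function.support (φ.normed volume) := hxy
                rw [φ.support_normed_eq, mem_ball_zero_iff, ← dist_eq_norm] at hlt
                gcongr
                rw [← ENNReal.ofReal_mul (Real.exp_pos _).le]
                refine ENNReal.ofReal_le_ofReal ((hlog x y).trans ?_)
                gcongr
                exact h0 y
          _ = ENNReal.ofReal (Real.exp (M * φ.rOut)) * ENNReal.ofReal (h y) := by
              rw [lintegral_mul_const _ (by fun_prop)]
              have : ∀ x, φ.normed volume (x - y) = φ.normed volume (y - x) := fun x => by
                rw [← φ.normed_neg, neg_sub]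
              simp only [this, lintegral_normed_sub_eq_one, one_mul]
    _ = _ := lintegral_const_mul _ (by fun_prop)

end Mollification

/-! ### From a Poincaré inequality for smooth functions to an eigenvalue bound -/

section SpectralGap

variable {E : Type*} [NormedAddCommGroup E] [InnerProductSpace ℝ E] [FiniteDimensional ℝ E]
  [MeasurableSpace E] [BorelSpace E]

/-- The measure with density `h` with respect to Lebesgue measure. -/
noncomputable def weightMeasure (h : E → ℝ) : Measure E :=
  volume.withDensity fun x => ENNReal.ofReal (h x)

instance (h : E → ℝ) : SFinite (weightMeasure h) := by
  unfold weightMeasure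
  infer_instance

theorem setLIntegral_weightMeasure {h : E → ℝ} (hh : Measurable h) {g : E → ℝ≥0∞}
    (hg : Measurable g) {s : Set E} (hs : MeasurableSet s) :
    ∫⁻ x in s, g x ∂(weightMeasure h) = ∫⁻ x in s, g x * ENNReal.ofReal (h x) := by
  rw [weightMeasure, setLIntegral_withDensity_eq_setLIntegral_mul _ (by fun_prop) hg hs]
  simp only [Pi.mul_apply, mul_comm]

theorem weightMeasure_one : weightMeasure (fun _ : E => (1 : ℝ)) = volume := by
  simp only [weightMeasure, ENNReal.ofReal_one]
  exact withDensity_one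

theorem weightMeasure_restrict_le {h : E → ℝ} {s : Set E} (hs : MeasurableSet s) {B : ℝ}
    (hB : ∀ x ∈ s, h x ≤ B) :
    (weightMeasure h).restrict s ≤ ENNReal.ofReal B • volume.restrict s := by
  rw [weightMeasure, restrict_withDensity hs, ← withDensity_const]
  exact withDensity_mono ((ae_restrict_mem hs).mono fun x hx => ENNReal.ofReal_le_ofReal (hB x hx))

theorem weightMeasure_lt_top {h : E → ℝ} {s : Set E} (hs : MeasurableSet s) {B : ℝ}
    (hB : ∀ x ∈ s, h x ≤ B) (hfin : volume s < ⊤) : weightMeasure h s < ⊤ := by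
  have := weightMeasure_restrict_le hs hB univ
  simp only [Measure.restrict_apply_univ, Measure.smul_apply, smul_eq_mul] at this
  exact this.trans_lt (ENNReal.mul_lt_top ENNReal.ofReal_lt_top hfin)

/-- A Poincaré inequality for smooth functions on sets exhausting `Ω`, with a uniform constant,
passes to `H¹(Ω)`: mollify and use Fatou's lemma. -/
theorem lintegral_lintegral_sub_sq_le_of_smooth {Ω : Set E} (hΩ : IsOpen Ω)
    (hb : Bornology.IsBounded Ω) {h : E → ℝ} {M B : ℝ} (hM : 0 ≤ M) (hm : Measurable h)
    (h0 : ∀ x, 0 ≤ h x) (hlog : ∀ x y, h x ≤ Real.exp (M * dist x y) * h y)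
    (hB : ∀ x ∈ Ω, h x ≤ B) {K : ℕ → Set E} (hK : ∀ n, MeasurableSet (K n))
    (hKΩ : ∀ n, closure (K n) ⊆ Ω) (hKx : ∀ x ∈ Ω, ∀ᶠ n in atTop, x ∈ K n) {C : ℝ≥0∞}
    (hC : ∀ n, ∀ f : E → ℝ, ContDiff ℝ ∞ f →
      ∫⁻ x in K n, ∫⁻ y in K n, ‖f x - f y‖ₑ ^ 2 ∂(weightMeasure h) ∂(weightMeasure h) ≤
        C * ∫⁻ x in K n, ‖fderiv ℝ f x‖ₑ ^ 2 ∂(weightMeasure h))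
    {p : Lp ℝ 2 (volume.restrict Ω) × Lp E 2 (volume.restrict Ω)} (hp : p ∈ sobolevH1 Ω) :
    ∫⁻ x in Ω, ∫⁻ y in Ω, ‖p.1 x - p.1 y‖ₑ ^ 2 ∂(weightMeasure h) ∂(weightMeasure h) ≤
      C * ∫⁻ x in Ω, ‖p.2 x‖ₑ ^ 2 ∂(weightMeasure h) := by
  have hΩm := hΩ.measurableSet
  have hvol : volume Ω < ⊤ := hb.measure_lt_top
  have : IsFiniteMeasure (volume.restrict Ω) := ⟨by simpa using hvol⟩
  have hfin : IsFiniteMeasure ((weightMeasure h).restrict Ω) :=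
    ⟨by simpa using weightMeasure_lt_top hΩm hB hvol⟩
  set ν := weightMeasure h with hν
  have hsf : SFinite ν := by rw [hν]; infer_instance
  have hKΩ' : ∀ n, K n ⊆ Ω := fun n => subset_closure.trans (hKΩ n)
  have hu1 : Measurable p.1 := (Lp.stronglyMeasurable p.1).measurable
  have hG1 : Measurable p.2 := (Lp.stronglyMeasurable p.2).measurable
  have hu : LocallyIntegrable (Ω.indicator p.1) volume :=
    ((integrable_indicator_iff hΩm).2
      ((Lp.memLp p.1).integrable (by norm_num))).locallyIntegrable
  -- the radii tend to zero and are so small that mollification on `K n` sees only points of `Ω`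
  have hr : ∀ n : ℕ, ∃ r : ℝ, 0 < r ∧ r ≤ 1 / ((n : ℝ) + 1) ∧
      ∀ x ∈ K n, Metric.closedBall x r ⊆ Ω := by
    intro n
    have hcpt : IsCompact (closure (K n)) := (hb.subset (hKΩ' n)).isCompact_closure
    obtain ⟨δ, hδ, hδΩ⟩ := hcpt.exists_cthickening_subset_open hΩ (hKΩ n)
    refine ⟨min δ (1 / ((n : ℝ) + 1)), lt_min hδ (by positivity), min_le_right _ _, fun x hx => ?_⟩
    exact (Metric.closedBall_subset_closedBall (min_le_left _ _)).trans
      ((Metric.closedBall_subset_cthickening (subset_closure hx) δ).trans hδΩ)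
  choose r hr0 hr1 hrΩ using hr
  have hrt : Tendsto r atTop (𝓝 0) :=
    squeeze_zero (fun n => (hr0 n).le) hr1 tendsto_one_div_add_atTop_nhds_zero_nat
  let φ : ℕ → ContDiffBump (0 : E) := fun n =>
    ⟨r n / 2, r n, by have := hr0 n; positivity, by have := hr0 n; linarith⟩
  set f : ℕ → E → ℝ := fun n => mollify Ω (φ n) p.1 with hf
  have hfs : ∀ n, ContDiff ℝ ∞ (f n) := fun n => contDiff_mollify (φ n) hu
  have hfm : ∀ n, Measurable (f n) := fun n => (hfs n).continuous.measurable
  have hconv : ∀ᵐ x ∂(ν.restrict Ω), x ∈ Ω ∧ Tendsto (fun n => f n x) atTop (𝓝 (p.1 x)) := by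
    have h1 : ∀ᵐ x ∂(volume : Measure E),
        Tendsto (fun n => f n x) atTop (𝓝 (Ω.indicator p.1 x)) :=
      ContDiffBump.ae_convolution_tendsto_right_of_locallyIntegrable (K := 2)
        hrt (Eventually.of_forall fun n => by simp [φ]; linarith) hu
    have h2 : ∀ᵐ x ∂ν, Tendsto (fun n => f n x) atTop (𝓝 (Ω.indicator p.1 x)) :=
      (withDensity_absolutelyContinuous _ _).ae_le h1
    filter_upwards [ae_restrict_mem hΩm, ae_restrict_of_ae h2] with x hx hx2
    rw [indicator_of_mem hx] at hx2
    exact ⟨hx, hx2⟩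
  have hen : ∀ n, ∫⁻ x in K n, ‖fderiv ℝ (f n) x‖ₑ ^ 2 ∂ν ≤
      ENNReal.ofReal (Real.exp (M * r n)) * ∫⁻ x in Ω, ‖p.2 x‖ₑ ^ 2 ∂ν := by
    intro n
    have hfd : Measurable fun x => ‖fderiv ℝ (f n) x‖ₑ ^ 2 :=
      ((hfs n).continuous_fderiv (by simp)).enorm.measurable.pow_const 2
    rw [hν, setLIntegral_weightMeasure hm hfd (hK n),
      setLIntegral_weightMeasure hm (by fun_prop) hΩm]
    exact lintegral_enorm_fderiv_mollify_sq_le hΩm (φ n) hp hu (hK n) (hrΩ n) hM hm h0 hlog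
  set F : ℕ → E × E → ℝ≥0∞ := fun n =>
    (K n ×ˢ K n).indicator fun z => ‖f n z.1 - f n z.2‖ₑ ^ 2 with hF
  have hFm : ∀ n, Measurable (F n) := fun n =>
    Measurable.indicator (by have := hfm n; fun_prop) ((hK n).prod (hK n))
  have hFint : ∀ n, ∫⁻ z, F n z ∂((ν.restrict Ω).prod (ν.restrict Ω)) ≤
      C * (ENNReal.ofReal (Real.exp (M * r n)) * ∫⁻ x in Ω, ‖p.2 x‖ₑ ^ 2 ∂ν) := by
    intro n
    have := hfm n
    rw [hF, lintegral_indicator ((hK n).prod (hK n)), ← Measure.prod_restrict,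
      Measure.restrict_restrict (hK n), inter_eq_self_of_subset_left (hKΩ' n),
      lintegral_prod _ (by fun_prop)]
    exact (hC n _ (hfs n)).trans (by gcongr; exact hen n)
  have hlim : ∀ᵐ z ∂((ν.restrict Ω).prod (ν.restrict Ω)),
      Tendsto (fun n => F n z) atTop (𝓝 (‖p.1 z.1 - p.1 z.2‖ₑ ^ 2)) := by
    filter_upwards [Measure.quasiMeasurePreserving_fst.ae hconv,
      Measure.quasiMeasurePreserving_snd.ae hconv] with z hz1 hz2
    have hev : ∀ᶠ n in atTop, ‖f n z.1 - f n z.2‖ₑ ^ 2 = F n z := by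
      filter_upwards [hKx z.1 hz1.1, hKx z.2 hz2.1] with n h1 h2
      rw [hF]
      exact (indicator_of_mem (show z ∈ K n ×ˢ K n from ⟨h1, h2⟩)
        fun z : E × E => ‖f n z.1 - f n z.2‖ₑ ^ 2).symm
    refine Tendsto.congr' hev ?_
    exact ((ENNReal.continuous_pow 2).tendsto _).comp
      ((continuous_enorm.tendsto _).comp (hz1.2.sub hz2.2))
  calc ∫⁻ x in Ω, ∫⁻ y in Ω, ‖p.1 x - p.1 y‖ₑ ^ 2 ∂ν ∂ν
      = ∫⁻ z, ‖p.1 z.1 - p.1 z.2‖ₑ ^ 2 ∂((ν.restrict Ω).prod (ν.restrict Ω)) := by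
        rw [lintegral_prod _ (by fun_prop)]
    _ = ∫⁻ z, liminf (fun n => F n z) atTop ∂((ν.restrict Ω).prod (ν.restrict Ω)) :=
        lintegral_congr_ae (hlim.mono fun z hz => hz.liminf_eq.symm)
    _ ≤ liminf (fun n => ∫⁻ z, F n z ∂((ν.restrict Ω).prod (ν.restrict Ω))) atTop :=
        lintegral_liminf_le hFm
    _ ≤ liminf (fun n => C * (ENNReal.ofReal (Real.exp (M * r n)) *
          ∫⁻ x in Ω, ‖p.2 x‖ₑ ^ 2 ∂ν)) atTop := liminf_le_liminf (Eventually.of_forall hFint)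
    _ = C * ∫⁻ x in Ω, ‖p.2 x‖ₑ ^ 2 ∂ν := by
        refine Tendsto.liminf_eq ?_
        have h1 : Tendsto (fun n => ENNReal.ofReal (Real.exp (M * r n))) atTop (𝓝 1) := by
          rw [← ENNReal.ofReal_one, ← Real.exp_zero, ← mul_zero M]
          exact (ENNReal.continuous_ofReal.tendsto _).comp
            ((Real.continuous_exp.tendsto _).comp (hrt.const_mul M))
        have h2 : Tendsto (fun n => ENNReal.ofReal (Real.exp (M * r n)) *
            (C * ∫⁻ x in Ω, ‖p.2 x‖ₑ ^ 2 ∂ν)) atTop (𝓝 (1 * (C * ∫⁻ x in Ω, ‖p.2 x‖ₑ ^ 2 ∂ν))) :=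
          ENNReal.Tendsto.mul_const h1 (Or.inl one_ne_zero)
        rw [one_mul] at h2
        simpa only [mul_left_comm] using h2

theorem Lp.eq_zero_of_lintegral_enorm_sq_mul_eq_zero {F : Type*} [NormedAddCommGroup F]
    [MeasurableSpace F] [BorelSpace F] {Ω : Set E} {h : E → ℝ} (hm : Measurable h)
    (h0 : ∀ x, 0 < h x) {w : Lp F 2 (volume.restrict Ω)}
    (hw : ∫⁻ x in Ω, ‖w x‖ₑ ^ 2 * ENNReal.ofReal (h x) = 0) : w = 0 := by
  have hwm : Measurable fun x => ‖w x‖ₑ ^ 2 * ENNReal.ofReal (h x) :=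
    ((Lp.stronglyMeasurable w).enorm.pow_const 2).mul (by fun_prop)
  rw [lintegral_eq_zero_iff hwm] at hw
  rw [Lp.eq_zero_iff_ae_eq_zero]
  filter_upwards [hw] with x hx
  simpa [(h0 x).not_ge] using hx

/-- A Poincaré inequality for smooth functions on sets exhausting `Ω` bounds the first nontrivial
min-max value from below. -/
theorem inv_le_minMaxValue_one {Ω : Set E} (hΩ : IsOpen Ω) (hne : Ω.Nonempty)
    (hb : Bornology.IsBounded Ω) {h : E → ℝ} {M B : ℝ} (hM : 0 ≤ M) (hm : Measurable h)
    (h0 : ∀ x, 0 < h x) (hlog : ∀ x y, h x ≤ Real.exp (M * dist x y) * h y)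
    (hB : ∀ x ∈ Ω, h x ≤ B) {K : ℕ → Set E} (hK : ∀ n, MeasurableSet (K n))
    (hKΩ : ∀ n, closure (K n) ⊆ Ω) (hKx : ∀ x ∈ Ω, ∀ᶠ n in atTop, x ∈ K n) {C : ℝ≥0∞}
    (hC : ∀ n, ∀ f : E → ℝ, ContDiff ℝ ∞ f →
      ∫⁻ x in K n, ∫⁻ y in K n, ‖f x - f y‖ₑ ^ 2 ∂(weightMeasure h) ∂(weightMeasure h) ≤
        2 * weightMeasure h Ω * C * ∫⁻ x in K n, ‖fderiv ℝ f x‖ₑ ^ 2 ∂(weightMeasure h)) :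
    C⁻¹ ≤ minMaxValue 1 Ω h := by
  have hΩm := hΩ.measurableSet
  have hvol : volume Ω < ⊤ := hb.measure_lt_top
  have hνfin := weightMeasure_lt_top hΩm hB hvol
  have hfin : IsFiniteMeasure ((weightMeasure h).restrict Ω) := ⟨by simpa using hνfin⟩
  have hν0 : weightMeasure h Ω ≠ 0 := by
    intro hz
    rw [weightMeasure, withDensity_apply_eq_zero (by fun_prop)] at hz
    have : {x | ENNReal.ofReal (h x) ≠ 0} ∩ Ω = Ω :=
      inter_eq_right.2 fun x _ => by simpa using h0 x
    rw [this] at hz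
    exact (hΩ.measure_pos volume hne).ne' hz
  -- the space `V` enters only through one of its nonzero elements, which has mean zero
  refine le_iInf₂ fun V hV => ?_
  obtain ⟨hVH, hVf, hV1, hV0⟩ := hV
  have hVnt : Nontrivial V := Module.finrank_pos_iff.1 (hV1 ▸ one_pos)
  obtain ⟨⟨p, hpV⟩, hp0⟩ := exists_ne (0 : V)
  have hpne : p ≠ 0 := fun h => hp0 (Subtype.ext h)
  refine le_trans ?_ (le_iSup₂ (f := fun p (_ : p ∈ {p | p ∈ V ∧ p ≠ 0}) =>
    rayleighQuotient Ω h p) p ⟨hpV, hpne⟩)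
  have hu1 : Measurable p.1 := (Lp.stronglyMeasurable p.1).measurable
  have hG1 : Measurable p.2 := (Lp.stronglyMeasurable p.2).measurable
  have hmem : MemLp p.1 2 ((weightMeasure h).restrict Ω) :=
    (Lp.memLp p.1).of_measure_le_smul ENNReal.ofReal_ne_top (weightMeasure_restrict_le hΩm hB)
  have hmean : ∫ x in Ω, p.1 x ∂(weightMeasure h) = 0 := by
    rw [weightMeasure, restrict_withDensity hΩm,
      integral_withDensity_eq_integral_toReal_smul (by fun_prop)
        (ae_of_all _ fun x => ENNReal.ofReal_lt_top), ← hV0 p hpV]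
    congr 1 with x
    rw [ENNReal.toReal_ofReal (h0 x).le, smul_eq_mul, mul_comm]
  have key := lintegral_lintegral_sub_sq_le_of_smooth hΩ hb hM hm (fun x => (h0 x).le) hlog hB hK
    hKΩ hKx hC (hVH hpV)
  rw [lintegral_lintegral_enorm_sub_sq_of_integral_eq_zero hmem hmean, Measure.restrict_apply_univ,
    mul_assoc _ C, ENNReal.mul_le_mul_iff_right (by simpa using hν0)
      (ENNReal.mul_ne_top ENNReal.ofNat_ne_top hνfin.ne)] at key
  have hDfin : ∫⁻ x in Ω, ‖p.1 x‖ₑ ^ 2 ∂(weightMeasure h) ≠ ⊤ := by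
    have := hmem.eLpNorm_lt_top
    rw [eLpNorm_lt_top_iff_lintegral_rpow_enorm_lt_top (by norm_num) (by norm_num)] at this
    simpa using this.ne
  rw [setLIntegral_weightMeasure hm (by fun_prop) hΩm,
    setLIntegral_weightMeasure hm (by fun_prop) hΩm] at key
  rw [setLIntegral_weightMeasure hm (by fun_prop) hΩm] at hDfin
  rw [rayleighQuotient, ENNReal.le_div_iff_mul_le _ (Or.inl hDfin)]
  · rw [mul_comm, ← div_eq_mul_inv]
    exact ENNReal.div_le_of_le_mul' key
  -- a vanishing denominator is harmless unless the numerator vanishes as well; then `p = 0`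
  · by_contra hcon
    push Not at hcon
    exact hpne (Prod.ext (Lp.eq_zero_of_lintegral_enorm_sq_mul_eq_zero hm h0 hcon.1)
      (Lp.eq_zero_of_lintegral_enorm_sq_mul_eq_zero hm h0 hcon.2))

end SpectralGap

/-! ### The first positive root of the plateau equation -/

theorem exists_mem_plateauRoots {a : ℝ} (ha : 0 < a) (ha2 : a < 1 / 2) :
    ∃ w ∈ plateauRoots a, w * (1 / 2 - a) < Real.pi / 2 := by
  have hb : 0 < 1 / 2 - a := by linarith
  set b := 1 / 2 - a with hbdef
  have hR : 0 < Real.pi / 2 / b := div_pos (by positivity) hb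
  have hcont : ContinuousOn (fun x => a * x * Real.sin (x * b) - (1 + a * x) * Real.cos (x * b))
      (Icc 0 (Real.pi / 2 / b)) := by fun_prop
  have hend : Real.pi / 2 / b * b = Real.pi / 2 := by field_simp
  obtain ⟨w, ⟨hw0, hw1⟩, hw⟩ := intermediate_value_Ioo hR.le hcont
    (show (0 : ℝ) ∈ Ioo _ _ by
      simp only [mul_zero, zero_mul, hend, Real.sin_pi_div_two, Real.cos_pi_div_two]
      constructor
      · norm_num
      · simp only [mul_one, sub_zero]; positivity)
  have hwb : w * b < Real.pi / 2 := by rwa [lt_div_iff₀ hb] at hw1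
  have hcos : 0 < Real.cos (w * b) :=
    Real.cos_pos_of_mem_Ioo ⟨by have := mul_pos hw0 hb; have := Real.pi_pos; linarith, hwb⟩
  refine ⟨w, ⟨hw0, hcos.ne', ?_⟩, hwb⟩
  rw [Real.tan_eq_sin_div_cos, div_eq_iff hcos.ne']
  simp only at hw
  have h1 : 1 + 1 / (a * w) = (1 + a * w) / (a * w) := by field_simp; ring
  rw [h1, div_mul_eq_mul_div, eq_div_iff (by positivity)]
  linarith

/-- On the first branch of the tangent the left side of the plateau equation increases and its
right side decreases, so that the root found there is the least one. -/
theorem isLeast_plateauRoots {a : ℝ} (ha : 0 < a) (ha2 : a < 1 / 2) :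
    IsLeast (plateauRoots a) (plateauRoot a) ∧ plateauRoot a * (1 / 2 - a) < Real.pi / 2 := by
  obtain ⟨w, hw, hwb⟩ := exists_mem_plateauRoots ha ha2
  have hb : 0 < 1 / 2 - a := by linarith
  have hl : IsLeast (plateauRoots a) w := by
    refine ⟨hw, fun x hx => ?_⟩
    by_contra! hxw
    have h1 : Real.tan (x * (1 / 2 - a)) < Real.tan (w * (1 / 2 - a)) :=
      Real.tan_lt_tan_of_nonneg_of_lt_pi_div_two (mul_pos hx.1 hb).le hwb
        (mul_lt_mul_of_pos_right hxw hb)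
    rw [hx.2.2, hw.2.2] at h1
    have h2 : 1 / (a * w) < 1 / (a * x) :=
      one_div_lt_one_div_of_lt (mul_pos ha hx.1) (mul_lt_mul_of_pos_left hxw ha)
    linarith
  rw [plateauRoot, hl.csInf_eq]
  exact ⟨hl, hwb⟩

theorem pi_div_four_lt_plateauRoot_mul {a : ℝ} (ha : 0 < a) (ha2 : a < 1 / 2) :
    Real.pi / 4 < plateauRoot a * (1 / 2 - a) := by
  obtain ⟨hl, hwb⟩ := isLeast_plateauRoots ha ha2
  by_contra! hle
  have hpos : 0 < plateauRoot a * (1 / 2 - a) := mul_pos hl.1.1 (by linarith)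
  have h1 : Real.tan (plateauRoot a * (1 / 2 - a)) ≤ Real.tan (Real.pi / 4) := by
    rcases hle.eq_or_lt with h | h
    · rw [h]
    · exact (Real.tan_lt_tan_of_nonneg_of_lt_pi_div_two hpos.le
        (by have := Real.pi_pos; linarith) h).le
  rw [hl.1.2.2, Real.tan_pi_div_four] at h1
  have : 0 < 1 / (a * plateauRoot a) := one_div_pos.2 (mul_pos ha hl.1.1)
  linarith

theorem eventually_lt_one_half : ∀ᶠ a : ℝ in 𝓝[<] (1 / 2 : ℝ), 0 < a ∧ a < 1 / 2 :=
  (eventually_nhdsWithin_of_eventually_nhds (lt_mem_nhds (by norm_num))).and self_mem_nhdsWithin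

theorem tendsto_plateauRoot : Tendsto plateauRoot (𝓝[<] (1 / 2 : ℝ)) atTop := by
  have h1 : Tendsto (fun a : ℝ => 1 / 2 - a) (𝓝[<] (1 / 2 : ℝ)) (𝓝[>] 0) := by
    refine tendsto_nhdsWithin_iff.2 ⟨?_, ?_⟩
    · have : Tendsto (fun a : ℝ => 1 / 2 - a) (𝓝 (1 / 2 : ℝ)) (𝓝 (1 / 2 - 1 / 2)) :=
        tendsto_const_nhds.sub tendsto_id
      rw [sub_self] at this
      exact this.mono_left nhdsWithin_le_nhds
    · filter_upwards [eventually_lt_one_half] with a ha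
      exact sub_pos.2 ha.2
  refine tendsto_atTop_mono' _ ?_
    ((tendsto_inv_nhdsGT_zero.comp h1).const_mul_atTop (by positivity : 0 < Real.pi / 4))
  filter_upwards [eventually_lt_one_half] with a ha
  have := pi_div_four_lt_plateauRoot_mul ha.1 ha.2
  have hb : 0 < 1 / 2 - a := sub_pos.2 ha.2
  rw [Function.comp_apply, ← div_eq_mul_inv, div_le_iff₀ hb]
  exact this.le

/-! ### The plateau weight and its odd eigenfunction -/

/-- The function given by `f₁` on `(-∞, a)`, `f₂` on `[a, 1 - a]` and `f₃` on `(1 - a, ∞)`. -/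
noncomputable def threePieces (a : ℝ) (f₁ f₂ f₃ : ℝ → ℝ) (x : ℝ) : ℝ :=
  if x < a then f₁ x else if x ≤ 1 - a then f₂ x else f₃ x

theorem continuous_threePieces {a : ℝ} (ha : a < 1 / 2) {f₁ f₂ f₃ : ℝ → ℝ} (h₁ : Continuous f₁)
    (h₂ : Continuous f₂) (h₃ : Continuous f₃) (e₁ : f₁ a = f₂ a) (e₂ : f₂ (1 - a) = f₃ (1 - a)) :
    Continuous (threePieces a f₁ f₂ f₃) := by
  have h23 : Continuous fun x => if x ≤ 1 - a then f₂ x else f₃ x :=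
    h₂.if_le h₃ continuous_id continuous_const fun x hx => by rw [hx]; exact e₂
  have : threePieces a f₁ f₂ f₃ =
      fun x => if a ≤ x then (if x ≤ 1 - a then f₂ x else f₃ x) else f₁ x := by
    ext x
    simp only [threePieces]
    split_ifs <;> first | rfl | (exfalso; linarith)
  rw [this]
  refine h23.if_le h₁ continuous_const continuous_id fun x hx => ?_
  rw [← hx, if_pos (by linarith), e₁]

theorem hasDerivAt_threePieces {a : ℝ} {f₁ f₂ f₃ f₁' f₂' f₃' : ℝ → ℝ}
    (h₁ : ∀ x, HasDerivAt f₁ (f₁' x) x) (h₂ : ∀ x, HasDerivAt f₂ (f₂' x) x)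
    (h₃ : ∀ x, HasDerivAt f₃ (f₃' x) x) {x : ℝ} (hx : x ∉ ({a, 1 - a} : Set ℝ)) :
    HasDerivAt (threePieces a f₁ f₂ f₃) (threePieces a f₁' f₂' f₃' x) x := by
  simp only [mem_insert_iff, mem_singleton_iff, not_or] at hx
  rcases lt_or_gt_of_ne hx.1 with h | h
  · rw [threePieces, if_pos h]
    refine (h₁ x).congr_of_eventuallyEq ?_
    filter_upwards [Iio_mem_nhds h] with y hy
    rw [threePieces, if_pos (show y < a from hy)]
  rcases lt_or_gt_of_ne hx.2 with h' | h'
  · rw [threePieces, if_neg (by linarith), if_pos h'.le]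
    refine (h₂ x).congr_of_eventuallyEq ?_
    filter_upwards [Ioi_mem_nhds h, Iio_mem_nhds h'] with y hy hy'
    rw [threePieces, if_neg (not_lt.2 (le_of_lt hy)), if_pos (le_of_lt hy')]
  · rw [threePieces, if_neg (by linarith), if_neg (by linarith)]
    refine (h₃ x).congr_of_eventuallyEq ?_
    filter_upwards [Ioi_mem_nhds h, Ioi_mem_nhds h'] with y hy hy'
    rw [threePieces, if_neg (not_lt.2 (le_of_lt hy)), if_neg (not_le.2 hy')]

theorem threePieces_mul (a : ℝ) (f₁ f₂ f₃ g₁ g₂ g₃ : ℝ → ℝ) (x : ℝ) :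
    threePieces a f₁ f₂ f₃ x * threePieces a g₁ g₂ g₃ x =
      threePieces a (fun x => f₁ x * g₁ x) (fun x => f₂ x * g₂ x) (fun x => f₃ x * g₃ x) x := by
  simp only [threePieces]
  split_ifs <;> rfl

theorem plateauWeight_eq_threePieces (a : ℝ) :
    plateauWeight a = threePieces a (fun x => Real.exp (2 * plateauRoot a * (x - a)))
      (fun _ => 1) (fun x => Real.exp (2 * plateauRoot a * (1 - x - a))) := rfl

theorem plateauWeight_eq_exp {a : ℝ} (ha2 : a < 1 / 2) (x : ℝ) :
    plateauWeight a x =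
      Real.exp (-(2 * plateauRoot a * max 0 (max (a - x) (x - (1 - a))))) := by
  rw [plateauWeight]
  split_ifs with h1 h2
  · rw [max_eq_left (a := a - x) (by linarith), max_eq_right (by linarith)]
    congr 1; ring
  · rw [max_eq_left (b := max _ _) (max_le (by linarith) (by linarith)), mul_zero, neg_zero,
      Real.exp_zero]
  · rw [max_eq_right (b := x - (1 - a)) (by linarith), max_eq_right (by linarith)]
    congr 1; ring

theorem plateauWeight_pos {a : ℝ} (ha2 : a < 1 / 2) (x : ℝ) : 0 < plateauWeight a x := by
  rw [plateauWeight_eq_exp ha2]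
  exact Real.exp_pos _

theorem continuous_plateauWeight {a : ℝ} (ha2 : a < 1 / 2) : Continuous (plateauWeight a) := by
  simp only [funext (plateauWeight_eq_exp ha2)]
  fun_prop

theorem plateauWeight_le_one {a : ℝ} (ha : 0 < a) (ha2 : a < 1 / 2) (x : ℝ) :
    plateauWeight a x ≤ 1 := by
  rw [plateauWeight_eq_exp ha2, Real.exp_le_one_iff, neg_nonpos]
  have := (isLeast_plateauRoots ha ha2).1.1.1
  positivity

theorem plateauWeight_le_exp_mul {a : ℝ} (ha : 0 < a) (ha2 : a < 1 / 2) (x y : ℝ) :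
    plateauWeight a x ≤ Real.exp (2 * plateauRoot a * dist x y) * plateauWeight a y := by
  have hw := (isLeast_plateauRoots ha ha2).1.1.1
  rw [plateauWeight_eq_exp ha2, plateauWeight_eq_exp ha2, ← Real.exp_add, Real.exp_le_exp,
    Real.dist_eq]
  have h1 := neg_abs_le (x - y)
  have h2 := le_abs_self (x - y)
  have h : max 0 (max (a - y) (y - (1 - a))) ≤ max 0 (max (a - x) (x - (1 - a))) + |x - y| := by
    refine max_le (by positivity) (max_le ?_ ?_)
    · have : a - x ≤ max 0 (max (a - x) (x - (1 - a))) :=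
        (le_max_left _ _).trans (le_max_right _ _)
      linarith
    · have : x - (1 - a) ≤ max 0 (max (a - x) (x - (1 - a))) :=
        (le_max_right _ _).trans (le_max_right _ _)
      linarith
  nlinarith

/-- The amplitude of the eigenfunction near the end points, which makes it continuous. -/
noncomputable def plateauAmplitude (a : ℝ) : ℝ :=
  Real.sin (plateauRoot a * (1 / 2 - a)) * Real.exp (plateauRoot a * a) / (1 + plateauRoot a * a)

/-- The odd (with respect to `1/2`) solution `u` of `(g_a u')' = - w_a² g_a u` with
`u'(0) = u'(1) = 0`. -/
noncomputable def plateauEigenfunction (a : ℝ) : ℝ → ℝ :=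
  threePieces a
    (fun x => -(plateauAmplitude a * (1 + plateauRoot a * x) * Real.exp (-(plateauRoot a * x))))
    (fun x => Real.sin (plateauRoot a * (x - 1 / 2)))
    (fun x => plateauAmplitude a * (1 + plateauRoot a * (1 - x)) *
      Real.exp (-(plateauRoot a * (1 - x))))

/-- The derivative of `plateauEigenfunction`. -/
noncomputable def plateauEigenfunctionDeriv (a : ℝ) : ℝ → ℝ :=
  threePieces a
    (fun x => plateauAmplitude a * plateauRoot a ^ 2 * x * Real.exp (-(plateauRoot a * x)))
    (fun x => plateauRoot a * Real.cos (plateauRoot a * (x - 1 / 2)))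
    (fun x => plateauAmplitude a * plateauRoot a ^ 2 * (1 - x) *
      Real.exp (-(plateauRoot a * (1 - x))))

theorem plateauRoot_pos {a : ℝ} (ha : 0 < a) (ha2 : a < 1 / 2) : 0 < plateauRoot a :=
  (isLeast_plateauRoots ha ha2).1.1.1

theorem sin_plateauRoot_mul_pos {a : ℝ} (ha : 0 < a) (ha2 : a < 1 / 2) :
    0 < Real.sin (plateauRoot a * (1 / 2 - a)) :=
  Real.sin_pos_of_pos_of_lt_pi (mul_pos (plateauRoot_pos ha ha2) (by linarith))
    (by linarith [(isLeast_plateauRoots ha ha2).2, Real.pi_pos])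

theorem plateauAmplitude_pos {a : ℝ} (ha : 0 < a) (ha2 : a < 1 / 2) : 0 < plateauAmplitude a := by
  have := sin_plateauRoot_mul_pos ha ha2
  have := plateauRoot_pos ha ha2
  rw [plateauAmplitude]
  positivity

theorem plateauAmplitude_mul {a : ℝ} (ha : 0 < a) (ha2 : a < 1 / 2) :
    plateauAmplitude a * (1 + plateauRoot a * a) * Real.exp (-(plateauRoot a * a)) =
      Real.sin (plateauRoot a * (1 / 2 - a)) := by
  have := plateauRoot_pos ha ha2
  rw [plateauAmplitude, Real.exp_neg]
  field_simp

/-- The equation defining `w_a` matches the derivatives at the ends of the plateau. -/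
theorem plateauAmplitude_mul_sq {a : ℝ} (ha : 0 < a) (ha2 : a < 1 / 2) :
    plateauAmplitude a * plateauRoot a ^ 2 * a * Real.exp (-(plateauRoot a * a)) =
      plateauRoot a * Real.cos (plateauRoot a * (1 / 2 - a)) := by
  have hw := plateauRoot_pos ha ha2
  obtain ⟨-, hcos, htan⟩ := (isLeast_plateauRoots ha ha2).1.1
  rw [Real.tan_eq_sin_div_cos, div_eq_iff hcos] at htan
  have h1 := plateauAmplitude_mul ha ha2
  rw [htan] at h1
  have h2 : 1 + 1 / (a * plateauRoot a) = (1 + plateauRoot a * a) / (a * plateauRoot a) := by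
    field_simp
    ring
  have h3 : (1 + plateauRoot a * a) ≠ 0 := by positivity
  rw [h2, div_mul_eq_mul_div, eq_div_iff (by positivity)] at h1
  have h4 : plateauAmplitude a * Real.exp (-(plateauRoot a * a)) * (a * plateauRoot a) =
      Real.cos (plateauRoot a * (1 / 2 - a)) := by
    apply mul_left_cancel₀ h3
    linear_combination h1
  linear_combination plateauRoot a * h4

theorem continuous_plateauEigenfunction {a : ℝ} (ha : 0 < a) (ha2 : a < 1 / 2) :
    Continuous (plateauEigenfunction a) := by
  have h := plateauAmplitude_mul ha ha2
  refine continuous_threePieces ha2 (by fun_prop) (by fun_prop) (by fun_prop) ?_ ?_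
  · rw [h, ← Real.sin_neg]
    congr 1; ring
  · rw [sub_sub_cancel, h]
    congr 1; ring

theorem continuous_plateauEigenfunctionDeriv {a : ℝ} (ha : 0 < a) (ha2 : a < 1 / 2) :
    Continuous (plateauEigenfunctionDeriv a) := by
  have h := plateauAmplitude_mul_sq ha ha2
  refine continuous_threePieces ha2 (by fun_prop) (by fun_prop) (by fun_prop) ?_ ?_
  · rw [h, ← Real.cos_neg]
    congr 2; ring
  · rw [sub_sub_cancel, h]
    congr 2; ring

theorem hasDerivAt_plateauEigenfunction {a x : ℝ} (hx : x ∉ ({a, 1 - a} : Set ℝ)) :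
    HasDerivAt (plateauEigenfunction a) (plateauEigenfunctionDeriv a x) x := by
  refine hasDerivAt_threePieces (fun x => ?_) (fun x => ?_) (fun x => ?_) hx
  · have h1 : HasDerivAt (fun x => plateauRoot a * x) (plateauRoot a) x := by
      simpa using (hasDerivAt_id x).const_mul (plateauRoot a)
    have h1n : HasDerivAt (fun x => -(plateauRoot a * x)) (-plateauRoot a) x := h1.neg
    convert! (((h1.const_add 1).const_mul (plateauAmplitude a)).mul h1n.exp).neg using 1
    ring
  · have h1 : HasDerivAt (fun x => plateauRoot a * (x - 1 / 2)) (plateauRoot a) x := by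
      simpa only [id, mul_one] using
        ((hasDerivAt_id x).sub_const (1 / 2 : ℝ)).const_mul (plateauRoot a)
    convert! h1.sin using 1
    ring
  · have h1 : HasDerivAt (fun x => plateauRoot a * (1 - x)) (-plateauRoot a) x := by
      simpa using ((hasDerivAt_id x).const_sub 1).const_mul (plateauRoot a)
    have h1n : HasDerivAt (fun x => -(plateauRoot a * (1 - x))) (- -plateauRoot a) x := h1.neg
    convert! ((h1.const_add 1).const_mul (plateauAmplitude a)).mul h1n.exp using 1
    ring

theorem hasDerivAt_plateauWeight_mul_deriv {a x : ℝ} (hx : x ∉ ({a, 1 - a} : Set ℝ)) :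
    HasDerivAt (fun x => plateauWeight a x * plateauEigenfunctionDeriv a x)
      (-plateauRoot a ^ 2 * (plateauWeight a x * plateauEigenfunction a x)) x := by
  simp only [plateauWeight_eq_threePieces, plateauEigenfunctionDeriv, plateauEigenfunction,
    threePieces_mul]
  have e : ∀ f₁ f₂ f₃ : ℝ → ℝ, -plateauRoot a ^ 2 * threePieces a f₁ f₂ f₃ x = threePieces a
      (fun x => -plateauRoot a ^ 2 * f₁ x) (fun x => -plateauRoot a ^ 2 * f₂ x)
      (fun x => -plateauRoot a ^ 2 * f₃ x) x := by
    intro f₁ f₂ f₃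
    simp only [threePieces]
    split_ifs <;> rfl
  rw [e]
  refine hasDerivAt_threePieces (fun x => ?_) (fun x => ?_) (fun x => ?_) hx
  · have h1 : HasDerivAt (fun x => plateauRoot a * x) (plateauRoot a) x := by
      simpa using (hasDerivAt_id x).const_mul (plateauRoot a)
    have h1n : HasDerivAt (fun x => -(plateauRoot a * x)) (-plateauRoot a) x := h1.neg
    have h2 : HasDerivAt (fun x => 2 * plateauRoot a * (x - a)) (2 * plateauRoot a) x := by
      simpa using ((hasDerivAt_id x).sub_const a).const_mul (2 * plateauRoot a)
    have h3 : HasDerivAt (fun x => plateauAmplitude a * plateauRoot a ^ 2 * x)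
        (plateauAmplitude a * plateauRoot a ^ 2) x := by
      simpa using (hasDerivAt_id x).const_mul (plateauAmplitude a * plateauRoot a ^ 2)
    convert! h2.exp.mul (h3.mul h1n.exp) using 1
    simp only [Pi.mul_apply]
    ring
  · have h1 : HasDerivAt (fun x => plateauRoot a * (x - 1 / 2)) (plateauRoot a) x := by
      simpa only [id, mul_one] using
        ((hasDerivAt_id x).sub_const (1 / 2 : ℝ)).const_mul (plateauRoot a)
    convert! (h1.cos.const_mul (plateauRoot a)).const_mul 1 using 1
    ring
  · have h1 : HasDerivAt (fun x => plateauRoot a * (1 - x)) (-plateauRoot a) x := by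
      simpa using ((hasDerivAt_id x).const_sub 1).const_mul (plateauRoot a)
    have h1n : HasDerivAt (fun x => -(plateauRoot a * (1 - x))) (- -plateauRoot a) x := h1.neg
    have h2 : HasDerivAt (fun x => 2 * plateauRoot a * (1 - x - a)) (-(2 * plateauRoot a)) x := by
      simpa using (((hasDerivAt_id x).const_sub 1).sub_const a).const_mul (2 * plateauRoot a)
    have h3 : HasDerivAt (fun x => plateauAmplitude a * plateauRoot a ^ 2 * (1 - x))
        (-(plateauAmplitude a * plateauRoot a ^ 2)) x := by
      simpa using ((hasDerivAt_id x).const_sub 1).const_mul (plateauAmplitude a * plateauRoot a ^ 2)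
    convert! h2.exp.mul (h3.mul h1n.exp) using 1
    simp only [Pi.mul_apply]
    ring

theorem plateauEigenfunctionDeriv_pos {a : ℝ} (ha : 0 < a) (ha2 : a < 1 / 2) {x : ℝ}
    (hx0 : 0 < x) (hx1 : x < 1) : 0 < plateauEigenfunctionDeriv a x := by
  have hA := plateauAmplitude_pos ha ha2
  have hw := plateauRoot_pos ha ha2
  have hwb := (isLeast_plateauRoots ha ha2).2
  rw [plateauEigenfunctionDeriv, threePieces]
  split_ifs with h1 h2
  · positivity
  · push Not at h1
    refine mul_pos hw (Real.cos_pos_of_mem_Ioo ⟨?_, ?_⟩) <;> nlinarith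
  · have : 0 < 1 - x := by linarith
    positivity

theorem plateauEigenfunctionDeriv_zero {a : ℝ} (ha : 0 < a) :
    plateauEigenfunctionDeriv a 0 = 0 := by
  simp [plateauEigenfunctionDeriv, threePieces, ha]

theorem plateauEigenfunctionDeriv_one {a : ℝ} (ha : 0 < a) (ha2 : a < 1 / 2) :
    plateauEigenfunctionDeriv a 1 = 0 := by
  rw [plateauEigenfunctionDeriv, threePieces, if_neg (by linarith), if_neg (by linarith)]
  simp

theorem plateauEigenfunction_one_half {a : ℝ} (ha2 : a < 1 / 2) :
    plateauEigenfunction a (1 / 2) = 0 := by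
  rw [plateauEigenfunction, threePieces, if_neg (by linarith), if_pos (by linarith)]
  simp

theorem countable_plateauBreaks (a : ℝ) : ({a, 1 - a} : Set ℝ).Countable :=
  (Set.toFinite _).countable

theorem integral_plateauEigenfunctionDeriv {a : ℝ} (ha : 0 < a) (ha2 : a < 1 / 2) (t : ℝ) :
    ∫ s in (1 / 2)..t, plateauEigenfunctionDeriv a s = plateauEigenfunction a t := by
  rw [integral_eq_of_hasDerivAt_off_countable _ _ (countable_plateauBreaks a)
    (continuous_plateauEigenfunction ha ha2).continuousOn
    (fun x hx => hasDerivAt_plateauEigenfunction hx.2)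
    ((continuous_plateauEigenfunctionDeriv ha ha2).intervalIntegrable _ _),
    plateauEigenfunction_one_half ha2, sub_zero]

theorem integral_plateauWeight_mul_eigenfunction {a : ℝ} (ha : 0 < a) (ha2 : a < 1 / 2)
    (s t : ℝ) : plateauRoot a ^ 2 * ∫ x in s..t, plateauWeight a x * plateauEigenfunction a x =
      plateauWeight a s * plateauEigenfunctionDeriv a s -
        plateauWeight a t * plateauEigenfunctionDeriv a t := by
  have h := integral_eq_of_hasDerivAt_off_countable
    (fun x => plateauWeight a x * plateauEigenfunctionDeriv a x) _ (countable_plateauBreaks a)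
    ((continuous_plateauWeight ha2).mul (continuous_plateauEigenfunctionDeriv ha ha2)).continuousOn
    (fun x hx => hasDerivAt_plateauWeight_mul_deriv hx.2)
    ((continuous_const.mul ((continuous_plateauWeight ha2).mul
      (continuous_plateauEigenfunction ha ha2))).intervalIntegrable s t)
  rw [intervalIntegral.integral_const_mul] at h
  linarith

theorem monotoneOn_plateauEigenfunction {a : ℝ} (ha : 0 < a) (ha2 : a < 1 / 2) :
    MonotoneOn (plateauEigenfunction a) (Icc 0 1) := by
  intro x hx y hy hxy
  have h := intervalIntegral.integral_interval_sub_left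
    ((continuous_plateauEigenfunctionDeriv ha ha2).intervalIntegrable (μ := volume) (1 / 2) y)
    ((continuous_plateauEigenfunctionDeriv ha ha2).intervalIntegrable (μ := volume) (1 / 2) x)
  rw [integral_plateauEigenfunctionDeriv ha ha2, integral_plateauEigenfunctionDeriv ha ha2] at h
  have := intervalIntegral.integral_nonneg (μ := volume) (f := plateauEigenfunctionDeriv a) hxy
    fun z hz => by
      rcases (hx.1.trans hz.1).eq_or_lt with h0 | h0
      · rw [← h0, plateauEigenfunctionDeriv_zero ha]
      rcases (hz.2.trans hy.2).eq_or_lt with h1 | h1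
      · rw [h1, plateauEigenfunctionDeriv_one ha ha2]
      · exact (plateauEigenfunctionDeriv_pos ha ha2 h0 h1).le
  linarith

/-! ### The first eigenvalue of the plateau weight -/

/-- Hardy's inequality for the plateau weight with base point `1/2`, by Schur's test with the
derivative of the odd eigenfunction. The constant `w_a⁻²` is sharp. -/
theorem lintegral_sq_mul_plateauWeight_le {a : ℝ} (ha : 0 < a) (ha2 : a < 1 / 2) {δ : ℝ}
    (hδ : 0 < δ) (hδ2 : δ < 1 / 2) {v G : ℝ → ℝ≥0∞} (hG : Measurable G)
    (hv : ∀ t ∈ Ioo δ (1 - δ), v t ≤ ∫⁻ s in uIoc (1 / 2) t, G s) :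
    ∫⁻ t in Ioo δ (1 - δ), v t ^ 2 * ENNReal.ofReal (plateauWeight a t) ≤
      ENNReal.ofReal (plateauRoot a ^ 2)⁻¹ *
        ∫⁻ s in Ioo δ (1 - δ), G s ^ 2 * ENNReal.ofReal (plateauWeight a s) := by
  have hw := plateauRoot_pos ha ha2
  have hu := continuous_plateauEigenfunction ha ha2
  have hu' := continuous_plateauEigenfunctionDeriv ha ha2
  have hh := continuous_plateauWeight ha2
  have hmono := monotoneOn_plateauEigenfunction ha ha2
  have hmid : (1 / 2 : ℝ) ∈ Icc (0 : ℝ) 1 := by norm_num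
  have hI : Ioo δ (1 - δ) ⊆ Ioo 0 1 := Ioo_subset_Ioo hδ.le (by linarith)
  have hseg : ∀ t ∈ Ioo δ (1 - δ), uIoc (1 / 2) t ⊆ Ioo δ (1 - δ) := by
    intro t ht s hs
    rw [mem_uIoc] at hs
    rcases hs with hs | hs
    · exact ⟨by linarith [hs.1], hs.2.trans_lt ht.2⟩
    · exact ⟨ht.1.trans hs.1, by linarith [hs.2]⟩
  refine lintegral_sq_mul_le_of_schur measurableSet_Ioo hseg
    (ψ := fun s => ENNReal.ofReal (plateauEigenfunctionDeriv a s))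
    (Φ := fun t => ENNReal.ofReal |plateauEigenfunction a t|) hG
    (by have := hu'.measurable; fun_prop) (by have := hu.measurable; fun_prop)
    (by have := hh.measurable; fun_prop) hv ?_ ?_ (fun s _ => ENNReal.ofReal_ne_top) ?_
  · intro t ht
    rw [← integral_plateauEigenfunctionDeriv ha ha2, intervalIntegral.abs_intervalIntegral_eq,
      ← ofReal_integral_eq_lintegral_ofReal]
    · exact ENNReal.ofReal_le_ofReal (le_abs_self _)
    · exact (hu'.integrableOn_uIoc)
    · refine (ae_restrict_mem measurableSet_uIoc).mono fun s hs => ?_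
      have := hI (hseg t ht hs)
      exact (plateauEigenfunctionDeriv_pos ha ha2 this.1 this.2).le
  · intro s hs
    rw [Ne, ENNReal.ofReal_eq_zero, not_le]
    exact plateauEigenfunctionDeriv_pos ha ha2 (hI hs).1 (hI hs).2
  · intro s hs
    have hcm : Continuous fun t => |plateauEigenfunction a t| * plateauWeight a t :=
      hu.abs.mul hh
    -- the integral of the eigenfunction beyond `s` is its flux at `s`
    have key : ∀ (S : Set ℝ) (l r : ℝ), l ≤ r → S ⊆ Icc l r →
        ∫ t in l..r, |plateauEigenfunction a t| * plateauWeight a t =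
          (plateauRoot a ^ 2)⁻¹ * (plateauWeight a s * plateauEigenfunctionDeriv a s) →
        ∫⁻ t in S, ENNReal.ofReal |plateauEigenfunction a t| *
          ENNReal.ofReal (plateauWeight a t) ≤ ENNReal.ofReal (plateauRoot a ^ 2)⁻¹ *
          (ENNReal.ofReal (plateauWeight a s) *
            ENNReal.ofReal (plateauEigenfunctionDeriv a s)) := by
      intro S l r hlr hS hint
      rw [← ENNReal.ofReal_mul (plateauWeight_pos ha2 s).le,
        ← ENNReal.ofReal_mul (by positivity), ← hint, intervalIntegral.integral_of_le hlr,
        ← integral_Icc_eq_integral_Ioc, ofReal_integral_eq_lintegral_ofReal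
          hcm.integrableOn_Icc (ae_of_all _ fun t =>
            mul_nonneg (abs_nonneg _) (plateauWeight_pos ha2 t).le)]
      refine (lintegral_mono_set hS).trans (le_of_eq ?_)
      congr 1 with t
      rw [ENNReal.ofReal_mul (abs_nonneg _)]
    have hsign : ∀ t, 1 / 2 ≤ t → t ≤ 1 → |plateauEigenfunction a t| = plateauEigenfunction a t :=
      fun t h1 h2 => abs_of_nonneg (by
        have := hmono hmid ⟨by linarith, h2⟩ h1
        rwa [plateauEigenfunction_one_half ha2] at this)
    have hsign' : ∀ t, 0 ≤ t → t ≤ 1 / 2 →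
        |plateauEigenfunction a t| = -plateauEigenfunction a t :=
      fun t h1 h2 => abs_of_nonpos (by
        have := hmono ⟨h1, by linarith⟩ hmid h2
        rwa [plateauEigenfunction_one_half ha2] at this)
    rcases le_or_gt s (1 / 2) with hs2 | hs2
    · refine key _ 0 s (hI hs).1.le ?_ ?_
      · rintro t ⟨ht, hst⟩
        rcases mem_uIoc.1 hst with h | h
        · linarith [h.1]
        · exact ⟨(hI ht).1.le, h.1.le⟩
      · have h1 := integral_plateauWeight_mul_eigenfunction ha ha2 0 s
        rw [plateauEigenfunctionDeriv_zero ha] at h1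
        have h2 : ∫ t in (0)..s, |plateauEigenfunction a t| * plateauWeight a t =
            ∫ t in (0)..s, -(plateauWeight a t * plateauEigenfunction a t) := by
          refine intervalIntegral.integral_congr fun t ht => ?_
          rw [uIcc_of_le (hI hs).1.le] at ht
          simp only [hsign' t ht.1 (ht.2.trans hs2)]
          ring
        rw [eq_inv_mul_iff_mul_eq₀ (by positivity), h2, intervalIntegral.integral_neg]
        linarith
    · refine key _ s 1 (hI hs).2.le ?_ ?_
      · rintro t ⟨ht, hst⟩
        rcases mem_uIoc.1 hst with h | h
        · exact ⟨h.2, (hI ht).2.le⟩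
        · linarith [h.2]
      · have h1 := integral_plateauWeight_mul_eigenfunction ha ha2 s 1
        rw [plateauEigenfunctionDeriv_one ha ha2] at h1
        have h2 : ∫ t in s..1, |plateauEigenfunction a t| * plateauWeight a t =
            ∫ t in s..1, plateauWeight a t * plateauEigenfunction a t := by
          refine intervalIntegral.integral_congr fun t ht => ?_
          rw [uIcc_of_le (hI hs).2.le] at ht
          simp only [hsign t (hs2.le.trans ht.1) ht.2]
          ring
        rw [eq_inv_mul_iff_mul_eq₀ (by positivity), h2]
        linarith

theorem ofReal_plateauRoot_sq_le_relaxedEigenvalue {a : ℝ} (ha : 0 < a) (ha2 : a < 1 / 2) :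
    ENNReal.ofReal (plateauRoot a ^ 2) ≤ relaxedEigenvalue 1 (plateauWeight a) := by
  have hw := plateauRoot_pos ha ha2
  have hh := continuous_plateauWeight ha2
  set K : ℕ → Set ℝ := fun n => Ioo (1 / ((n : ℝ) + 3)) (1 - 1 / ((n : ℝ) + 3)) with hK
  have hδ0 : ∀ n : ℕ, 0 < 1 / ((n : ℝ) + 3) := fun n => by positivity
  have hδ1 : ∀ n : ℕ, 1 / ((n : ℝ) + 3) < 1 / 2 := fun n =>
    one_div_lt_one_div_of_lt (by norm_num) (by linarith [n.cast_nonneg (α := ℝ)])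
  have hKΩ : ∀ n, K n ⊆ Ioo 0 1 := fun n => Ioo_subset_Ioo (hδ0 n).le (by linarith [hδ0 n])
  have hlim : Tendsto (fun n : ℕ => 1 / ((n : ℝ) + 3)) atTop (𝓝 0) := by
    simp only [one_div]
    exact tendsto_inv_atTop_zero.comp
      (tendsto_atTop_add_const_right _ _ tendsto_natCast_atTop_atTop)
  have hνfin : weightMeasure (plateauWeight a) (Ioo 0 1) < ⊤ :=
    weightMeasure_lt_top measurableSet_Ioo (fun x _ => plateauWeight_le_one ha ha2 x) (by simp)
  have e : ENNReal.ofReal (plateauRoot a ^ 2) = (ENNReal.ofReal (plateauRoot a ^ 2)⁻¹)⁻¹ := by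
    rw [← ENNReal.ofReal_inv_of_pos (by positivity), inv_inv]
  rw [e, relaxedEigenvalue]
  refine inv_le_minMaxValue_one isOpen_Ioo (nonempty_Ioo.2 one_pos) (Metric.isBounded_Ioo 0 1)
    (M := 2 * plateauRoot a) (B := 1) (by positivity) hh.measurable (plateauWeight_pos ha2)
    (plateauWeight_le_exp_mul ha ha2) (fun x _ => plateauWeight_le_one ha ha2 x) (K := K)
    (fun n => measurableSet_Ioo) (fun n => ?_) (fun x hx => ?_) (fun n f hf => ?_)
  · refine (closure_mono Ioo_subset_Icc_self).trans ?_
    rw [closure_Icc]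
    exact fun x hx => ⟨(hδ0 n).trans_le hx.1, hx.2.trans_lt (by linarith [hδ0 n])⟩
  · filter_upwards [hlim.eventually_lt_const hx.1,
      hlim.eventually_lt_const (sub_pos.2 hx.2)] with n h1 h2
    exact ⟨h1, by linarith⟩
  · have hfin : IsFiniteMeasure ((weightMeasure (plateauWeight a)).restrict (K n)) :=
      ⟨by simpa using (measure_mono (hKΩ n)).trans_lt hνfin⟩
    have hfb : ∃ B, ∀ x ∈ Icc (0 : ℝ) 1, ‖f x‖ ≤ B :=
      isCompact_Icc.exists_bound_of_continuousOn hf.continuous.continuousOn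
    obtain ⟨B, hB⟩ := hfb
    have hmem : MemLp f 2 ((weightMeasure (plateauWeight a)).restrict (K n)) :=
      MemLp.of_bound hf.continuous.aestronglyMeasurable B
        ((ae_restrict_mem measurableSet_Ioo).mono fun x hx =>
          hB x (Ioo_subset_Icc_self (hKΩ n hx)))
    have hfm : Measurable f := hf.continuous.measurable
    have hfdm : Measurable (deriv f) := measurable_deriv f
    have hfdm' : Measurable (fderiv ℝ f) := measurable_fderiv ℝ f
    have hne : ∀ x, ‖fderiv ℝ f x‖ₑ = ‖deriv f x‖ₑ := fun x => by
      rw [← ofReal_norm, ← ofReal_norm, norm_deriv_eq_norm_fderiv]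
    refine (lintegral_lintegral_enorm_sub_sq_le hmem (f (1 / 2))).trans ?_
    rw [Measure.restrict_apply_univ, mul_assoc _ (ENNReal.ofReal _)]
    gcongr
    · exact hKΩ n
    · rw [setLIntegral_weightMeasure hh.measurable (by fun_prop) measurableSet_Ioo,
        setLIntegral_weightMeasure hh.measurable (by fun_prop) measurableSet_Ioo]
      simp only [hne]
      refine lintegral_sq_mul_plateauWeight_le ha ha2 (hδ0 n) (hδ1 n) (by fun_prop)
        fun t _ => ?_
      exact enorm_sub_le_lintegral_enorm_deriv countable_empty hf.continuous
        (fun x _ => ((hf.differentiable (by simp)) x).hasDerivAt) hfdm _ _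

theorem plateauEigenfunction_mem_sobolevH1 {a : ℝ} (ha : 0 < a) (ha2 : a < 1 / 2)
    (h1 : MemLp (plateauEigenfunction a) 2 (volume.restrict (Ioo 0 1)))
    (h2 : MemLp (plateauEigenfunctionDeriv a) 2 (volume.restrict (Ioo 0 1))) :
    (h1.toLp, h2.toLp) ∈ sobolevH1 (Ioo (0 : ℝ) 1) := by
  intro φ hφ hφc hφs v
  have hu := continuous_plateauEigenfunction ha ha2
  have hu' := continuous_plateauEigenfunctionDeriv ha ha2
  have hφd : Continuous (deriv φ) := hφ.continuous_deriv (by simp)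
  have hout : ∀ x, x ∉ Ioo (0 : ℝ) 1 → φ x = 0 := fun x hx =>
    image_eq_zero_of_notMem_tsupport fun h => hx (hφs h)
  have hparts := integral_eq_of_hasDerivAt_off_countable
    (fun x => plateauEigenfunction a x * φ x)
    (fun x => plateauEigenfunctionDeriv a x * φ x + plateauEigenfunction a x * deriv φ x)
    (a := 0) (b := 1) (countable_plateauBreaks a) (hu.mul hφ.continuous).continuousOn
    (fun x hx => (hasDerivAt_plateauEigenfunction hx.2).mul
      ((hφ.differentiable (by simp)) x).hasDerivAt)
    (((hu'.mul hφ.continuous).add (hu.mul hφd)).intervalIntegrable _ _)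
  have c1 : Continuous fun x => plateauEigenfunctionDeriv a x * φ x := hu'.mul hφ.continuous
  have c2 : Continuous fun x => plateauEigenfunction a x * deriv φ x := hu.mul hφd
  rw [hout 0 (by simp), hout 1 (by simp), mul_zero, mul_zero, sub_zero,
    intervalIntegral.integral_add (c1.intervalIntegrable _ _) (c2.intervalIntegrable _ _),
    intervalIntegral.integral_of_le zero_le_one,
    intervalIntegral.integral_of_le zero_le_one, integral_Ioc_eq_integral_Ioo,
    integral_Ioc_eq_integral_Ioo] at hparts
  have e1 : ∫ x in Ioo 0 1, h1.toLp (plateauEigenfunction a) x * fderiv ℝ φ x v =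
      ∫ x in Ioo 0 1, (plateauEigenfunction a x * deriv φ x) * v := by
    refine integral_congr_ae ?_
    filter_upwards [h1.coeFn_toLp] with x hx
    rw [hx, fderiv_eq_smul_deriv, smul_eq_mul]
    ring
  have e2 : ∫ x in Ioo 0 1, inner ℝ (h2.toLp (plateauEigenfunctionDeriv a) x) v * φ x =
      ∫ x in Ioo 0 1, (plateauEigenfunctionDeriv a x * φ x) * v := by
    refine integral_congr_ae ?_
    filter_upwards [h2.coeFn_toLp] with x hx
    rw [hx]
    simp only [RCLike.inner_apply, conj_trivial]
    ring
  rw [e1, e2, integral_mul_const, integral_mul_const]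
  linear_combination v * hparts

theorem integral_plateauEigenfunctionDeriv_sq {a : ℝ} (ha : 0 < a) (ha2 : a < 1 / 2) :
    ∫ x in (0)..1, plateauEigenfunctionDeriv a x ^ 2 * plateauWeight a x =
      plateauRoot a ^ 2 * ∫ x in (0)..1, plateauEigenfunction a x ^ 2 * plateauWeight a x := by
  have hu := continuous_plateauEigenfunction ha ha2
  have hu' := continuous_plateauEigenfunctionDeriv ha ha2
  have hh := continuous_plateauWeight ha2
  have c1 : Continuous fun x => plateauEigenfunctionDeriv a x ^ 2 * plateauWeight a x :=
    (hu'.pow 2).mul hh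
  have c2 : Continuous fun x =>
      plateauRoot a ^ 2 * (plateauEigenfunction a x ^ 2 * plateauWeight a x) :=
    continuous_const.mul ((hu.pow 2).mul hh)
  have h := integral_eq_of_hasDerivAt_off_countable
    (fun x => plateauEigenfunction a x * (plateauWeight a x * plateauEigenfunctionDeriv a x))
    (fun x => plateauEigenfunctionDeriv a x ^ 2 * plateauWeight a x -
      plateauRoot a ^ 2 * (plateauEigenfunction a x ^ 2 * plateauWeight a x))
    (a := 0) (b := 1) (countable_plateauBreaks a) (hu.mul (hh.mul hu')).continuousOn
    (fun x hx => by
      convert! (hasDerivAt_plateauEigenfunction hx.2).mul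
        (hasDerivAt_plateauWeight_mul_deriv hx.2) using 1
      ring)
    ((c1.sub c2).intervalIntegrable _ _)
  rw [plateauEigenfunctionDeriv_zero ha, plateauEigenfunctionDeriv_one ha ha2,
    intervalIntegral.integral_sub (c1.intervalIntegrable _ _) (c2.intervalIntegrable _ _),
    intervalIntegral.integral_const_mul] at h
  linarith

theorem relaxedEigenvalue_plateauWeight_le {a : ℝ} (ha : 0 < a) (ha2 : a < 1 / 2) :
    relaxedEigenvalue 1 (plateauWeight a) ≤ ENNReal.ofReal (plateauRoot a ^ 2) := by
  have hw := plateauRoot_pos ha ha2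
  have hu := continuous_plateauEigenfunction ha ha2
  have hu' := continuous_plateauEigenfunctionDeriv ha ha2
  have hh := continuous_plateauWeight ha2
  have hL2 : ∀ f : ℝ → ℝ, Continuous f → MemLp f 2 (volume.restrict (Ioo 0 1)) := by
    intro f hf
    obtain ⟨B, hB⟩ := isCompact_Icc (a := (0 : ℝ)) (b := 1) |>.exists_bound_of_continuousOn
      hf.continuousOn
    exact MemLp.of_bound hf.aestronglyMeasurable B
      ((ae_restrict_mem measurableSet_Ioo).mono fun x hx => hB x (Ioo_subset_Icc_self hx))
  have h1 := hL2 _ hu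
  have h2 := hL2 _ hu'
  set p : Lp ℝ 2 (volume.restrict (Ioo (0 : ℝ) 1)) × Lp ℝ 2 (volume.restrict (Ioo (0 : ℝ) 1)) :=
    (h1.toLp, h2.toLp) with hp
  have hpmem : p ∈ sobolevH1 (Ioo (0 : ℝ) 1) := plateauEigenfunction_mem_sobolevH1 ha ha2 h1 h2
  -- the gradient component does not vanish, since the derivative is positive on `(0, 1)`
  have hp0 : p ≠ 0 := by
    intro h0
    have h0' : h2.toLp = 0 := congrArg Prod.snd h0
    rw [Lp.eq_zero_iff_ae_eq_zero] at h0'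
    have hfalse : ∀ᵐ x ∂(volume.restrict (Ioo (0 : ℝ) 1)), False := by
      filter_upwards [h0', h2.coeFn_toLp, ae_restrict_mem measurableSet_Ioo] with x hx hx1 hx2
      exact (plateauEigenfunctionDeriv_pos ha ha2 hx2.1 hx2.2).ne' (hx1.symm.trans hx)
    rw [eventually_false_iff_eq_bot, ae_eq_bot, Measure.restrict_eq_zero, Real.volume_Ioo] at hfalse
    simp at hfalse
  have hsmul : ∀ c : ℝ, (∀ᵐ x ∂(volume.restrict (Ioo (0 : ℝ) 1)),
      (c • p).1 x = c * plateauEigenfunction a x) ∧ ∀ᵐ x ∂(volume.restrict (Ioo (0 : ℝ) 1)),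
      (c • p).2 x = c * plateauEigenfunctionDeriv a x := by
    intro c
    constructor
    · filter_upwards [Lp.coeFn_smul c p.1, h1.coeFn_toLp] with x hx hx2
      rw [Prod.smul_fst, hx, Pi.smul_apply, smul_eq_mul, hp, hx2]
    · filter_upwards [Lp.coeFn_smul c p.2, h2.coeFn_toLp] with x hx hx2
      rw [Prod.smul_snd, hx, Pi.smul_apply, smul_eq_mul, hp, hx2]
  have hV : Submodule.span ℝ {p} ∈ minMaxSpaces 1 (Ioo (0 : ℝ) 1) (plateauWeight a) := by
    refine ⟨(Submodule.span_singleton_le_iff_mem _ _).2 hpmem, inferInstance,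
      finrank_span_singleton hp0, fun q hq => ?_⟩
    obtain ⟨c, rfl⟩ := Submodule.mem_span_singleton.1 hq
    have e : ∫ x in Ioo 0 1, (c • p).1 x * plateauWeight a x =
        ∫ x in Ioo 0 1, c * (plateauWeight a x * plateauEigenfunction a x) := by
      refine integral_congr_ae ?_
      filter_upwards [(hsmul c).1] with x hx
      rw [hx]
      ring
    have hz := integral_plateauWeight_mul_eigenfunction ha ha2 0 1
    rw [plateauEigenfunctionDeriv_zero ha, plateauEigenfunctionDeriv_one ha ha2, mul_zero,
      mul_zero, sub_zero, intervalIntegral.integral_of_le zero_le_one,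
      integral_Ioc_eq_integral_Ioo] at hz
    rw [e, integral_const_mul, (mul_eq_zero.1 hz).resolve_left (by positivity), mul_zero]
  have hlint : ∀ (c : ℝ) (f : ℝ → ℝ), Continuous f →
      ∫⁻ x in Ioo 0 1, ‖c * f x‖ₑ ^ 2 * ENNReal.ofReal (plateauWeight a x) =
        ENNReal.ofReal (c ^ 2 * ∫ x in (0)..1, f x ^ 2 * plateauWeight a x) := by
    intro c f hf
    have hc : Continuous fun x => c ^ 2 * (f x ^ 2 * plateauWeight a x) :=
      continuous_const.mul ((hf.pow 2).mul hh)
    rw [← intervalIntegral.integral_const_mul, intervalIntegral.integral_of_le zero_le_one,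
      integral_Ioc_eq_integral_Ioo, ofReal_integral_eq_lintegral_ofReal
        (hc.integrableOn_Icc.mono_set Ioo_subset_Icc_self) (ae_of_all _ fun x => by
          have := (plateauWeight_pos ha2 x).le
          positivity)]
    congr 1 with x
    rw [enorm_sq_eq_ofReal, ← ENNReal.ofReal_mul (sq_nonneg _)]
    congr 1
    ring
  rw [relaxedEigenvalue]
  refine (iInf₂_le _ hV).trans (iSup₂_le fun q hq => ?_)
  obtain ⟨c, rfl⟩ := Submodule.mem_span_singleton.1 hq.1
  have e1 : ∫⁻ x in Ioo 0 1, ‖(c • p).1 x‖ₑ ^ 2 * ENNReal.ofReal (plateauWeight a x) = _ :=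
    (lintegral_congr_ae ((hsmul c).1.mono fun x hx => by simp only [hx])).trans (hlint c _ hu)
  have e2 : ∫⁻ x in Ioo 0 1, ‖(c • p).2 x‖ₑ ^ 2 * ENNReal.ofReal (plateauWeight a x) = _ :=
    (lintegral_congr_ae ((hsmul c).2.mono fun x hx => by simp only [hx])).trans (hlint c _ hu')
  rw [rayleighQuotient, e1, e2, integral_plateauEigenfunctionDeriv_sq ha ha2]
  refine ENNReal.div_le_of_le_mul ?_
  rw [← ENNReal.ofReal_mul (by positivity)]
  exact le_of_eq (congrArg _ (by ring))

theorem relaxedEigenvalue_plateauWeight {a : ℝ} (ha : 0 < a) (ha2 : a < 1 / 2) :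
    relaxedEigenvalue 1 (plateauWeight a) = ENNReal.ofReal (plateauRoot a ^ 2) :=
  le_antisymm (relaxedEigenvalue_plateauWeight_le ha ha2)
    (ofReal_plateauRoot_sq_le_relaxedEigenvalue ha ha2)

theorem tendsto_relaxedEigenvalue_plateauWeight :
    Tendsto (fun a : ℝ => relaxedEigenvalue 1 (plateauWeight a)) (𝓝[<] (1 / 2 : ℝ)) (𝓝 ⊤) := by
  have h : Tendsto (fun a => ENNReal.ofReal (plateauRoot a ^ 2)) (𝓝[<] (1 / 2 : ℝ)) (𝓝 ⊤) :=
    ENNReal.tendsto_ofReal_atTop.comp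
      ((tendsto_pow_atTop two_ne_zero).comp tendsto_plateauRoot)
  refine h.congr' ?_
  filter_upwards [eventually_lt_one_half] with a ha
  exact (relaxedEigenvalue_plateauWeight ha.1 ha.2).symm

/-! ### Domains star-shaped with respect to a ball -/

/-- An open set that is star-shaped with respect to every point of a ball has Lipschitz boundary:
near a boundary point `p` it contains, with each of its points, the nearby part of a cone opening
in the direction `-p`. Hence it is the region above the graph of the smallest Lipschitz function,
for a suitable constant, whose graph lies above the nearby points of the complement. -/
theorem hasLipschitzBoundary_of_starConvex {d : ℕ} {Ω : Set (EuclideanSpace ℝ (Fin d))}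
    (hΩ : IsOpen Ω) {ρ : ℝ} (hρ : 0 < ρ)
    (hstar : ∀ b ∈ Metric.ball (0 : EuclideanSpace ℝ (Fin d)) ρ, StarConvex ℝ b Ω) :
    HasLipschitzBoundary Ω := by
  intro p hp
  have hpΩ : p ∉ Ω := fun h => (hΩ.frontier_eq ▸ hp).2 h
  have hne : Ω.Nonempty := closure_nonempty_iff.1 ⟨p, frontier_subset_closure hp⟩
  have hpρ : ρ ≤ ‖p‖ := by
    by_contra! h
    exact hpΩ ((hstar p (by simpa using h)).mem hne)
  have hp0 : 0 < ‖p‖ := hρ.trans_le hpρ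
  set e : EuclideanSpace ℝ (Fin d) := -(‖p‖⁻¹ • p) with he
  have he1 : ‖e‖ = 1 := by rw [he, norm_neg, norm_smul, norm_inv, norm_norm, inv_mul_cancel₀ hp0.ne']
  have hpe : ‖p‖ • e = -p := by rw [he, smul_neg, smul_smul, mul_inv_cancel₀ hp0.ne', one_smul]
  have hee : inner ℝ e e = (1 : ℝ) := by rw [real_inner_self_eq_norm_sq, he1, one_pow]
  set P : EuclideanSpace ℝ (Fin d) → EuclideanSpace ℝ (Fin d) := fun x => x - (inner ℝ e x) • e
    with hP
  set U := Metric.ball p (ρ / 2) with hU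
  set K : ℝ≥0 := ⟨2 * ‖p‖ / ρ, by positivity⟩ with hK
  have hKv : (K : ℝ) = 2 * ‖p‖ / ρ := rfl
  have hcone : ∀ x ∈ U, x ∉ Ω → ∀ y ∈ U, y ∈ Ω →
      inner ℝ e x - inner ℝ e y ≤ K * ‖P y - P x‖ := by
    intro x hx hxΩ y hy hyΩ
    by_contra! hlt
    rw [← inner_sub_right] at hlt
    set s : ℝ := inner ℝ e (x - y) with hs
    have hs0 : 0 < s := lt_of_le_of_lt (by positivity) hlt
    have hsp : s < ‖p‖ := by
      have h1 : s ≤ ‖x - y‖ := by simpa [he1] using real_inner_le_norm e (x - y)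
      have h2 : ‖x - y‖ < ρ := by
        rw [← dist_eq_norm]
        linarith [dist_triangle_right x y p, Metric.mem_ball.1 hx, Metric.mem_ball.1 hy]
      linarith
    -- the point of the ball from which `x` is seen behind `y`
    set b := y - p + (‖p‖ / s) • (P x - P y) with hb
    have hbρ : b ∈ Metric.ball (0 : EuclideanSpace ℝ (Fin d)) ρ := by
      rw [mem_ball_zero_iff]
      have h1 : ‖y - p‖ < ρ / 2 := by rw [← dist_eq_norm]; exact hy
      have h2 : ‖(‖p‖ / s) • (P x - P y)‖ ≤ ρ / 2 := by
        rw [norm_smul, norm_div, norm_norm, Real.norm_of_nonneg hs0.le, norm_sub_rev,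
          div_mul_eq_mul_div, div_le_iff₀ hs0]
        rw [hKv, div_mul_eq_mul_div, div_lt_iff₀ hρ] at hlt
        linarith
      calc ‖b‖ ≤ ‖y - p‖ + ‖(‖p‖ / s) • (P x - P y)‖ := norm_add_le _ _
        _ < ρ := by linarith
    have hx' : (s / ‖p‖) • b + (1 - s / ‖p‖) • y = x := by
      have hPxy : P x - P y = x - y - s • e := by
        simp only [hP, hs, inner_sub_right]
        module
      have h3 : (s / ‖p‖) • (‖p‖ / s) • (x - y - s • e) = x - y - s • e := by
        rw [smul_smul, div_mul_div_comm, mul_comm s, div_self (by positivity), one_smul]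
      have h4 : (s / ‖p‖) • p = -(s • e) := by
        rw [show (s / ‖p‖) • p = -((s / ‖p‖) • ‖p‖ • e) by rw [hpe, smul_neg, neg_neg],
          smul_smul, div_mul_cancel₀ _ hp0.ne']
      rw [hb, hPxy, smul_add, h3, smul_sub, h4]
      module
    refine hxΩ (hx' ▸ hstar b hbρ hyΩ (by positivity) ?_ (by ring))
    rw [sub_nonneg, div_le_one hp0]
    exact hsp.le
  have hpU : p ∈ U := Metric.mem_ball_self (by positivity)
  let S := {x // x ∈ U ∧ x ∉ Ω}
  have : Nonempty S := ⟨⟨p, hpU, hpΩ⟩⟩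
  have hbdd : ∀ z, BddAbove (range fun x : S => inner ℝ e (x : EuclideanSpace ℝ (Fin d)) -
      K * ‖z - P x‖) := by
    intro z
    refine ⟨‖p‖ + ρ / 2, ?_⟩
    rintro _ ⟨x, rfl⟩
    have h1 : inner ℝ e (x : EuclideanSpace ℝ (Fin d)) ≤ ‖(x : EuclideanSpace ℝ (Fin d))‖ := by
      simpa [he1] using real_inner_le_norm e (x : EuclideanSpace ℝ (Fin d))
    have h2 : ‖(x : EuclideanSpace ℝ (Fin d))‖ ≤ ‖p‖ + ρ / 2 := by
      have := norm_le_norm_add_norm_sub p (x : EuclideanSpace ℝ (Fin d))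
      have h3 : dist (x : EuclideanSpace ℝ (Fin d)) p < ρ / 2 := x.2.1
      rw [dist_comm, dist_eq_norm] at h3
      linarith
    have h3 : 0 ≤ K * ‖z - P x‖ := by positivity
    simp only
    linarith
  refine ⟨U, Metric.ball_mem_nhds p (by positivity), e, he1, K,
    fun z => ⨆ x : S, (inner ℝ e (x : EuclideanSpace ℝ (Fin d)) - K * ‖z - P x‖), ?_, ?_⟩
  · refine LipschitzWith.of_le_add_mul K fun z z' => ciSup_le fun x => ?_
    have h1 := le_ciSup (hbdd z') x
    have h2 : ‖z' - P x‖ ≤ ‖z - P x‖ + dist z z' := by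
      have := norm_sub_le_norm_sub_add_norm_sub z' z (P x)
      rw [dist_comm, dist_eq_norm]
      linarith
    have h3 := mul_le_mul_of_nonneg_left h2 K.coe_nonneg
    rw [mul_add] at h3
    linarith
  · intro x hx
    constructor
    · intro hxΩ
      have hopen : IsOpen (U ∩ Ω) := Metric.isOpen_ball.inter hΩ
      have hcont : Continuous fun δ : ℝ => x - δ • e := by fun_prop
      have hev : ∀ᶠ δ in 𝓝[>] (0 : ℝ), x - δ • e ∈ U ∩ Ω :=
        eventually_nhdsWithin_of_eventually_nhds
          (hcont.continuousAt.eventually_mem (hopen.mem_nhds (by simpa using ⟨hx, hxΩ⟩)))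
      -- moving down by `δ` inside `Ω` turns the weak inequality of `hcone` into a strict one
      obtain ⟨δ, hδ, hδ0⟩ := (hev.and self_mem_nhdsWithin).exists
      have hPδ : P (x - δ • e) = P x := by
        simp only [hP, inner_sub_right, inner_smul_right, hee]
        module
      have hle : (⨆ x' : S, (inner ℝ e (x' : EuclideanSpace ℝ (Fin d)) - K * ‖P x - P x'‖)) ≤
          inner ℝ e x - δ := by
        refine ciSup_le fun x' => ?_
        have h := hcone x' x'.2.1 x'.2.2 _ hδ.1 hδ.2
        rw [hPδ, inner_sub_right, inner_smul_right, hee] at h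
        linarith
      have hδ0' : 0 < δ := hδ0
      exact hle.trans_lt (by linarith)
    · intro hlt
      by_contra hxΩ
      have h1 := le_ciSup (hbdd (P x)) ⟨x, hx, hxΩ⟩
      simp only [sub_self, norm_zero, mul_zero, sub_zero] at h1
      exact absurd hlt (not_lt.2 h1)

/-! ### Poincaré inequalities for exponential weights and on convex sets -/

theorem setIntegral_uIoc_exp_mul_abs (β t : ℝ) :
    ∫ s in uIoc 0 t, β * Real.exp (β * |s|) = Real.exp (β * |t|) - 1 := by
  have hpos : ∀ t : ℝ, 0 ≤ t →
      ∫ s in (0)..t, β * Real.exp (β * |s|) = Real.exp (β * |t|) - 1 := by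
    intro t ht
    have h1 : ∫ s in (0)..t, β * Real.exp (β * |s|) = ∫ s in (0)..t, β * Real.exp (β * s) := by
      refine intervalIntegral.integral_congr fun s hs => ?_
      rw [uIcc_of_le ht] at hs
      simp only [abs_of_nonneg hs.1]
    have h2 : ∀ x ∈ uIcc 0 t, HasDerivAt (fun s => Real.exp (β * s)) (β * Real.exp (β * x)) x := by
      intro x _
      have : HasDerivAt (fun s => β * s) β x := by simpa using (hasDerivAt_id x).const_mul β
      simpa [mul_comm] using this.exp
    rw [h1, intervalIntegral.integral_eq_sub_of_hasDerivAt h2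
      (Continuous.intervalIntegrable (by fun_prop) _ _), abs_of_nonneg ht, mul_zero, Real.exp_zero]
  rcases le_total 0 t with ht | ht
  · rw [uIoc_of_le ht, ← intervalIntegral.integral_of_le ht, hpos t ht]
  · rw [uIoc_of_ge ht, ← intervalIntegral.integral_of_le ht]
    have h := intervalIntegral.integral_comp_neg (fun s => β * Real.exp (β * |s|)) (a := 0) (b := -t)
    simp only [abs_neg, neg_neg, neg_zero] at h
    rw [← h, hpos (-t) (by linarith), abs_neg]

/-- Hardy's inequality for the weight `exp (-α |t|)`, with constant `4 / α²` independent of the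
length of the interval. -/
theorem lintegral_sq_mul_exp_le {α L : ℝ} (hα : 0 < α) {v G : ℝ → ℝ≥0∞}
    (hG : Measurable G) (hv : ∀ t ∈ Ioo (-L) L, v t ≤ ∫⁻ s in uIoc 0 t, G s) :
    ∫⁻ t in Ioo (-L) L, v t ^ 2 * ENNReal.ofReal (Real.exp (-(α * |t|))) ≤
      ENNReal.ofReal (4 / α ^ 2) *
        ∫⁻ s in Ioo (-L) L, G s ^ 2 * ENNReal.ofReal (Real.exp (-(α * |s|))) := by
  have hseg : ∀ t ∈ Ioo (-L) L, uIoc 0 t ⊆ Ioo (-L) L := by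
    intro t ht s hs
    rw [mem_uIoc] at hs
    rcases hs with hs | hs
    · exact ⟨by linarith [hs.1, ht.1, ht.2, hs.2], hs.2.trans_lt ht.2⟩
    · exact ⟨ht.1.trans hs.1, by linarith [hs.2, hs.1, ht.1]⟩
  -- the exponent `α / 2` of the test density minimizes the constant in Schur's test
  refine lintegral_sq_mul_le_of_schur measurableSet_Ioo hseg
    (ψ := fun s => ENNReal.ofReal (α / 2 * Real.exp (α / 2 * |s|)))
    (Φ := fun t => ENNReal.ofReal (Real.exp (α / 2 * |t|))) hG
    (by fun_prop) (by fun_prop) (by fun_prop) hv (fun t _ => ?_) (fun s _ => ?_)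
    (fun s _ => ENNReal.ofReal_ne_top) (fun s hs => ?_)
  · have hc : Continuous fun s => α / 2 * Real.exp (α / 2 * |s|) := by fun_prop
    rw [← ofReal_integral_eq_lintegral_ofReal hc.integrableOn_uIoc
      (ae_of_all _ fun s => by positivity), setIntegral_uIoc_exp_mul_abs]
    exact ENNReal.ofReal_le_ofReal (by linarith)
  · rw [Ne, ENNReal.ofReal_eq_zero, not_le]
    positivity
  · have e1 : ∀ t, ENNReal.ofReal (Real.exp (α / 2 * |t|)) *
        ENNReal.ofReal (Real.exp (-(α * |t|))) = ENNReal.ofReal (Real.exp (-(α / 2) * |t|)) := by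
      intro t
      rw [← ENNReal.ofReal_mul (Real.exp_pos _).le, ← Real.exp_add]
      congr 2
      ring
    have e2 : ENNReal.ofReal (4 / α ^ 2) * (ENNReal.ofReal (Real.exp (-(α * |s|))) *
        ENNReal.ofReal (α / 2 * Real.exp (α / 2 * |s|))) =
        ENNReal.ofReal (Real.exp (-(α / 2) * |s|) / (α / 2)) := by
      rw [← ENNReal.ofReal_mul (Real.exp_pos _).le, ← ENNReal.ofReal_mul (by positivity)]
      congr 1
      rw [mul_left_comm (Real.exp _), ← Real.exp_add,
        show -(α * |s|) + α / 2 * |s| = -(α / 2) * |s| by ring]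
      field_simp
      norm_num
    simp only [e1]
    rw [e2]
    rcases le_or_gt s 0 with hs0 | hs0
    · have hsub : Ioo (-L) L ∩ {t | s ∈ uIoc 0 t} ⊆ Iic s := by
        rintro t ⟨-, hst⟩
        rcases mem_uIoc.1 hst with h | h
        · linarith [h.1]
        · exact h.1.le
      calc ∫⁻ t in Ioo (-L) L ∩ {t | s ∈ uIoc 0 t}, ENNReal.ofReal (Real.exp (-(α / 2) * |t|))
          ≤ ∫⁻ t in Iic s, ENNReal.ofReal (Real.exp (-(α / 2) * |t|)) := lintegral_mono_set hsub
        _ = ∫⁻ t in Iic s, ENNReal.ofReal (Real.exp (α / 2 * t)) := by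
            refine setLIntegral_congr_fun measurableSet_Iic fun t ht => ?_
            have ht' : t ≤ s := ht
            simp only [abs_of_nonpos (ht'.trans hs0), neg_mul_neg]
        _ = ENNReal.ofReal (Real.exp (-(α / 2) * |s|) / (α / 2)) := by
            rw [← ofReal_integral_eq_lintegral_ofReal
              (integrableOn_exp_mul_Iic (by positivity) s) (ae_of_all _ fun t => (Real.exp_pos _).le),
              integral_exp_mul_Iic (by positivity), abs_of_nonpos hs0, neg_mul_neg]
    · have hsub : Ioo (-L) L ∩ {t | s ∈ uIoc 0 t} ⊆ Ici s := by
        rintro t ⟨-, hst⟩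
        rcases mem_uIoc.1 hst with h | h
        · exact h.2
        · linarith [h.2]
      calc ∫⁻ t in Ioo (-L) L ∩ {t | s ∈ uIoc 0 t}, ENNReal.ofReal (Real.exp (-(α / 2) * |t|))
          ≤ ∫⁻ t in Ici s, ENNReal.ofReal (Real.exp (-(α / 2) * |t|)) := lintegral_mono_set hsub
        _ = ∫⁻ t in Ioi s, ENNReal.ofReal (Real.exp (-(α / 2) * |t|)) :=
            setLIntegral_congr Ioi_ae_eq_Ici.symm
        _ = ∫⁻ t in Ioi s, ENNReal.ofReal (Real.exp (-(α / 2) * t)) := by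
            refine setLIntegral_congr_fun measurableSet_Ioi fun t ht => ?_
            have ht' : s < t := ht
            simp only [abs_of_pos (hs0.trans ht')]
        _ = ENNReal.ofReal (Real.exp (-(α / 2) * |s|) / (α / 2)) := by
            rw [← ofReal_integral_eq_lintegral_ofReal
              (integrableOn_exp_mul_Ioi (by linarith) s) (ae_of_all _ fun t => (Real.exp_pos _).le),
              integral_exp_mul_Ioi (by linarith), abs_of_pos hs0, neg_div_neg_eq]

theorem enorm_sub_sq_le_lintegral_segment {Y : Type*} [NormedAddCommGroup Y] [NormedSpace ℝ Y]
    {g : Y → ℝ} (hg : ContDiff ℝ 1 g) {x y : Y}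
    (hxy : ‖y - x‖ ≤ 2) :
    ‖g x - g y‖ₑ ^ 2 ≤ 4 * ∫⁻ s in Ioc (0 : ℝ) 1, ‖fderiv ℝ g ((1 - s) • x + s • y)‖ₑ ^ 2 := by
  have hline : ∀ s : ℝ, HasDerivAt (fun s : ℝ => (1 - s) • x + s • y) (y - x) s := by
    intro s
    have := (((hasDerivAt_id s).const_sub 1).smul_const x).add ((hasDerivAt_id s).smul_const y)
    convert! this using 1
    module
  have hdiff : Differentiable ℝ g := hg.differentiable one_ne_zero
  have hd : ∀ s ∉ (∅ : Set ℝ), HasDerivAt (fun s : ℝ => g ((1 - s) • x + s • y))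
      (fderiv ℝ g ((1 - s) • x + s • y) (y - x)) s := fun s _ =>
    (hdiff _).hasFDerivAt.comp_hasDerivAt s (hline s)
  have hcl : Continuous fun s : ℝ => (1 - s) • x + s • y := by fun_prop
  have hcd : Continuous fun s : ℝ => fderiv ℝ g ((1 - s) • x + s • y) (y - x) :=
    ((hg.continuous_fderiv one_ne_zero).comp hcl).clm_apply continuous_const
  have h := enorm_sub_le_lintegral_enorm_deriv countable_empty (hg.continuous.comp hcl) hd
    hcd.measurable 0 1
  simp only [Function.comp_apply, sub_self, zero_smul, one_smul, zero_add, sub_zero,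
    add_zero, uIoc_of_le zero_le_one] at h
  rw [← enorm_neg, neg_sub]
  have hm1 : Measurable fun s : ℝ => ‖fderiv ℝ g ((1 - s) • x + s • y) (y - x)‖ₑ :=
    hcd.enorm.measurable
  calc ‖g y - g x‖ₑ ^ 2
      ≤ (∫⁻ s in Ioc (0 : ℝ) 1, ‖fderiv ℝ g ((1 - s) • x + s • y) (y - x)‖ₑ * 1) ^ 2 := by
        simp only [mul_one]
        gcongr
    _ ≤ (∫⁻ s in Ioc (0 : ℝ) 1, ‖fderiv ℝ g ((1 - s) • x + s • y) (y - x)‖ₑ ^ 2) *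
          ∫⁻ s in Ioc (0 : ℝ) 1, 1 ^ 2 :=
        sq_lintegral_mul_le _ hm1.aemeasurable aemeasurable_const
    _ = ∫⁻ s in Ioc (0 : ℝ) 1, ‖fderiv ℝ g ((1 - s) • x + s • y) (y - x)‖ₑ ^ 2 := by simp
    _ ≤ ∫⁻ s in Ioc (0 : ℝ) 1, 4 * ‖fderiv ℝ g ((1 - s) • x + s • y)‖ₑ ^ 2 := by
        refine lintegral_mono fun s => ?_
        have h2 : ‖y - x‖ₑ ≤ 2 := by
          rw [← ofReal_norm, show (2 : ℝ≥0∞) = ENNReal.ofReal 2 by simp]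
          exact ENNReal.ofReal_le_ofReal hxy
        calc ‖fderiv ℝ g ((1 - s) • x + s • y) (y - x)‖ₑ ^ 2
            ≤ (‖fderiv ℝ g ((1 - s) • x + s • y)‖ₑ * 2) ^ 2 := by
              gcongr
              exact (ContinuousLinearMap.le_opENorm _ _).trans (by gcongr)
          _ = 4 * ‖fderiv ℝ g ((1 - s) • x + s • y)‖ₑ ^ 2 := by rw [mul_pow, mul_comm]; norm_num
    _ = 4 * ∫⁻ s in Ioc (0 : ℝ) 1, ‖fderiv ℝ g ((1 - s) • x + s • y)‖ₑ ^ 2 :=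
        lintegral_const_mul _ 
        (((hg.continuous_fderiv one_ne_zero).comp hcl).enorm.measurable.pow_const 2)

section Convex

variable {Y : Type*} [NormedAddCommGroup Y] [NormedSpace ℝ Y] [FiniteDimensional ℝ Y]
  [MeasurableSpace Y] [BorelSpace Y] (μ : Measure Y) [μ.IsAddHaarMeasure]

theorem lintegral_comp_smul_add {c : ℝ} (hc : 0 < c) (z : Y) {F : Y → ℝ≥0∞} (hF : Measurable F) :
    ∫⁻ y, F (c • y + z) ∂μ = ENNReal.ofReal ((c ^ Module.finrank ℝ Y)⁻¹) * ∫⁻ y, F y ∂μ := by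
  have hm : Measurable fun y => F (y + z) := by fun_prop
  have h := lintegral_map (μ := μ) hm (measurable_const_smul c)
  rw [Measure.map_addHaar_smul μ hc.ne', lintegral_smul_measure, lintegral_add_right_eq_self,
    abs_of_pos (by positivity), smul_eq_mul] at h
  exact h.symm

theorem setLIntegral_comp_smul_add_le {B : Set Y} (hB : MeasurableSet B) {c : ℝ} (hc : 1 / 2 ≤ c)
    {z : Y} (hcz : ∀ y ∈ B, c • y + z ∈ B) {F : Y → ℝ≥0∞} (hF : Measurable F) :
    ∫⁻ y in B, F (c • y + z) ∂μ ≤ 2 ^ Module.finrank ℝ Y * ∫⁻ y in B, F y ∂μ := by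
  have hc0 : 0 < c := by linarith
  calc ∫⁻ y in B, F (c • y + z) ∂μ
      ≤ ∫⁻ y, B.indicator F (c • y + z) ∂μ := by
        rw [← lintegral_indicator hB]
        refine lintegral_mono fun y => ?_
        by_cases hy : y ∈ B <;> simp [hy, hcz]
    _ = ENNReal.ofReal ((c ^ Module.finrank ℝ Y)⁻¹) * ∫⁻ y in B, F y ∂μ := by
        rw [lintegral_comp_smul_add μ hc0 z (hF.indicator hB), lintegral_indicator hB]
    _ ≤ _ := by
        gcongr
        rw [← inv_pow, ENNReal.ofReal_pow (by positivity)]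
        gcongr
        rw [show (2 : ℝ≥0∞) = ENNReal.ofReal 2 by simp]
        refine ENNReal.ofReal_le_ofReal ?_
        rw [inv_le_comm₀ hc0 two_pos]
        linarith

/-- One of the two end points of a segment enters the point `(1 - s) x + s y` with a coefficient at
least `1/2`; integrate over that end point first. -/
theorem Convex.lintegral_lintegral_segment_le {B : Set Y} (hB : MeasurableSet B)
    (hBc : Convex ℝ B) {H : Y → ℝ≥0∞} (hH : Continuous H) {s : ℝ} (hs : s ∈ Ioc (0 : ℝ) 1) :
    ∫⁻ x in B, ∫⁻ y in B, H ((1 - s) • x + s • y) ∂μ ∂μ ≤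
      2 ^ Module.finrank ℝ Y * μ B * ∫⁻ x in B, H x ∂μ := by
  have hcc : Continuous fun z : Y × Y => H ((1 - s) • z.1 + s • z.2) := hH.comp (by fun_prop)
  rcases le_or_gt s (1 / 2) with h | h
  · rw [lintegral_lintegral_swap hcc.measurable.aemeasurable]
    calc ∫⁻ y in B, ∫⁻ x in B, H ((1 - s) • x + s • y) ∂μ ∂μ
        ≤ ∫⁻ y in B, 2 ^ Module.finrank ℝ Y * ∫⁻ x in B, H x ∂μ ∂μ :=
          setLIntegral_mono' hB fun y hy => setLIntegral_comp_smul_add_le μ hB (by linarith)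
            (fun x hx => hBc hx hy (by linarith) hs.1.le (by ring)) hH.measurable
      _ = _ := by rw [setLIntegral_const]; ring
  · calc ∫⁻ x in B, ∫⁻ y in B, H ((1 - s) • x + s • y) ∂μ ∂μ
        ≤ ∫⁻ x in B, 2 ^ Module.finrank ℝ Y * ∫⁻ y in B, H y ∂μ ∂μ := by
          refine setLIntegral_mono' hB fun x hx => ?_
          simp only [add_comm ((1 - s) • x)]
          exact setLIntegral_comp_smul_add_le μ hB h.le
            (fun y hy => hBc hy hx hs.1.le (by linarith [hs.2]) (by ring)) hH.measurable
      _ = _ := by rw [setLIntegral_const]; ring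

theorem lintegral_lintegral_lintegral_rotate {X Z S : Type*} [MeasurableSpace X]
    [MeasurableSpace Z] [MeasurableSpace S] (μ : Measure X) (ν : Measure Z) (σ : Measure S)
    [SFinite μ] [SFinite ν] [SFinite σ] {k : X → Z → S → ℝ≥0∞}
    (hk : Measurable fun p : (X × Z) × S => k p.1.1 p.1.2 p.2) :
    ∫⁻ x, ∫⁻ z, ∫⁻ s, k x z s ∂σ ∂ν ∂μ = ∫⁻ s, ∫⁻ x, ∫⁻ z, k x z s ∂ν ∂μ ∂σ := by
  have h1 : ∀ x, ∫⁻ z, ∫⁻ s, k x z s ∂σ ∂ν = ∫⁻ s, ∫⁻ z, k x z s ∂ν ∂σ := fun x =>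
    lintegral_lintegral_swap
      (hk.comp ((measurable_const.prodMk measurable_fst).prodMk measurable_snd)).aemeasurable
  have h2 : Measurable fun q : (X × S) × Z => k q.1.1 q.2 q.1.2 :=
    hk.comp ((measurable_fst.fst.prodMk measurable_snd).prodMk measurable_fst.snd)
  have h3 : AEMeasurable (Function.uncurry fun x s => ∫⁻ z, k x z s ∂ν) (μ.prod σ) :=
    h2.lintegral_prod_right'.aemeasurable
  rw [lintegral_congr h1, lintegral_lintegral_swap h3]

/-- The Poincaré inequality on a convex set of diameter at most `2`: integrate the gradient along
segments. -/
theorem Convex.lintegral_lintegral_sub_sq_le {B : Set Y} (hB : MeasurableSet B) (hBc : Convex ℝ B)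
    (hBd : ∀ x ∈ B, ∀ y ∈ B, ‖y - x‖ ≤ 2) {g : Y → ℝ} (hg : ContDiff ℝ 1 g) :
    ∫⁻ x in B, ∫⁻ y in B, ‖g x - g y‖ₑ ^ 2 ∂μ ∂μ ≤
      4 * 2 ^ Module.finrank ℝ Y * μ B * ∫⁻ x in B, ‖fderiv ℝ g x‖ₑ ^ 2 ∂μ := by
  have hHc : Continuous fun x => ‖fderiv ℝ g x‖ₑ ^ 2 := (ENNReal.continuous_pow 2).comp
    (hg.continuous_fderiv one_ne_zero).enorm
  have h4c : Continuous fun x => 4 * ‖fderiv ℝ g x‖ₑ ^ 2 :=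
    (ENNReal.continuous_const_mul (by norm_num)).comp hHc
  have hc3 : Continuous fun z : (Y × Y) × ℝ =>
      4 * ‖fderiv ℝ g ((1 - z.2) • z.1.1 + z.2 • z.1.2)‖ₑ ^ 2 :=
    h4c.comp (g := fun x => 4 * ‖fderiv ℝ g x‖ₑ ^ 2) (by fun_prop)
  calc ∫⁻ x in B, ∫⁻ y in B, ‖g x - g y‖ₑ ^ 2 ∂μ ∂μ
      ≤ ∫⁻ x in B, ∫⁻ y in B, (∫⁻ s in Ioc (0 : ℝ) 1,
          4 * ‖fderiv ℝ g ((1 - s) • x + s • y)‖ₑ ^ 2) ∂μ ∂μ := by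
        refine setLIntegral_mono' hB fun x hx => setLIntegral_mono' hB fun y hy => ?_
        refine (enorm_sub_sq_le_lintegral_segment hg (hBd x hx y hy)).trans_eq ?_
        have hcl : Continuous fun s : ℝ => (1 - s) • x + s • y := by fun_prop
        exact (lintegral_const_mul _ (hHc.comp hcl).measurable).symm
    _ = ∫⁻ s in Ioc (0 : ℝ) 1, ∫⁻ x in B, ∫⁻ y in B,
          4 * ‖fderiv ℝ g ((1 - s) • x + s • y)‖ₑ ^ 2 ∂μ ∂μ :=
        lintegral_lintegral_lintegral_rotate _ _ _ hc3.measurable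
    _ ≤ ∫⁻ s in Ioc (0 : ℝ) 1, 2 ^ Module.finrank ℝ Y * μ B *
          ∫⁻ x in B, 4 * ‖fderiv ℝ g x‖ₑ ^ 2 ∂μ :=
        setLIntegral_mono' measurableSet_Ioc fun s hs =>
          Convex.lintegral_lintegral_segment_le μ hB hBc h4c hs
    _ = _ := by
        rw [setLIntegral_const, Real.volume_Ioc, lintegral_const_mul _ hHc.measurable]
        simp only [sub_zero, ENNReal.ofReal_one, mul_one]
        ring

end Convex

/-! ### Spindles with exponential profile -/

/-- The domain of `ℝⁿ⁺¹` around the segment `(-L, L)` of the first axis whose cross section at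
height `t` is a cube (the ball of the sup norm) of radius `ε exp (-κ |t|)`. -/
def spindle (n : ℕ) (L ε κ : ℝ) : Set (EuclideanSpace ℝ (Fin (n + 1))) :=
  {x | |x 0| < L ∧ ‖fun i : Fin n => x i.succ‖ < ε * Real.exp (-(κ * |x 0|))}

theorem isOpen_spindle (n : ℕ) (L ε κ : ℝ) : IsOpen (spindle n L ε κ) := by
  have h1 : Continuous fun x : EuclideanSpace ℝ (Fin (n + 1)) => |x 0| := by fun_prop
  have h2 : Continuous fun x : EuclideanSpace ℝ (Fin (n + 1)) => ‖fun i : Fin n => x i.succ‖ := by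
    fun_prop
  have h3 : Continuous fun x : EuclideanSpace ℝ (Fin (n + 1)) =>
      ε * Real.exp (-(κ * |x 0|)) := by fun_prop
  exact (isOpen_lt h1 continuous_const).inter (isOpen_lt h2 h3)

theorem norm_tail_le {n : ℕ} (x : EuclideanSpace ℝ (Fin (n + 1))) :
    ‖fun i : Fin n => x i.succ‖ ≤ ‖x‖ :=
  (pi_norm_le_iff_of_nonneg (norm_nonneg _)).2 fun i => PiLp.norm_apply_le x i.succ

theorem isBounded_spindle (n : ℕ) {L ε κ : ℝ} (hε : 0 < ε) (hκ : 0 ≤ κ) :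
    Bornology.IsBounded (spindle n L ε κ) := by
  have hcompl : spindle n L ε κ ⊆
      (EuclideanSpace.equiv (Fin (n + 1)) ℝ) ⁻¹' Metric.closedBall 0 (max L ε) := by
    intro x hx
    have hle : ε * Real.exp (-(κ * |x 0|)) ≤ ε :=
      mul_le_of_le_one_right hε.le (Real.exp_le_one_iff.2 (neg_nonpos.2 (by positivity)))
    rw [mem_preimage, mem_closedBall_zero_iff,
      pi_norm_le_iff_of_nonneg (hε.le.trans (le_max_right _ _))]
    refine Fin.cases (hx.1.le.trans (le_max_left _ _)) fun i => ?_
    exact (norm_le_pi_norm (fun i : Fin n => x i.succ) i).trans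
      (hx.2.le.trans (hle.trans (le_max_right _ _)))
  exact ((EuclideanSpace.equiv (Fin (n + 1)) ℝ).antilipschitz.isBounded_preimage
    Metric.isBounded_closedBall).subset hcompl

/-- The profile decreases away from the center at an at most exponential rate, so that the spindle
is star-shaped with respect to a small ball. -/
theorem starConvex_spindle (n : ℕ) {ε κ ρ : ℝ} (hε : 0 < ε) (hκ : 0 ≤ κ) (hρ1 : ρ ≤ 1)
    (hρκ : κ * ρ ≤ 1 / 2) (hρε : ρ ≤ ε * Real.exp (-κ) / 2)
    {b : EuclideanSpace ℝ (Fin (n + 1))} (hb : b ∈ Metric.ball 0 ρ) :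
    StarConvex ℝ b (spindle n 1 ε κ) := by
  intro x hx α β hα hβ hαβ
  rw [mem_ball_zero_iff] at hb
  have hb0 : |b 0| < ρ := (PiLp.norm_apply_le b 0).trans_lt hb
  have hbt : ‖fun i : Fin n => b i.succ‖ < ρ := (norm_tail_le b).trans_lt hb
  obtain ⟨hx0, hxt⟩ := hx
  have hρ : 0 < ρ := (abs_nonneg _).trans_lt hb0
  have habs : |(α • b + β • x) 0| ≤ α * |b 0| + β * |x 0| := by
    simp only [PiLp.add_apply, PiLp.smul_apply, smul_eq_mul]
    refine (abs_add_le _ _).trans (le_of_eq ?_)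
    rw [abs_mul, abs_mul, abs_of_nonneg hα, abs_of_nonneg hβ]
  have htail : ‖fun i : Fin n => (α • b + β • x) i.succ‖ ≤
      α * ‖fun i : Fin n => b i.succ‖ + β * ‖fun i : Fin n => x i.succ‖ := by
    have : (fun i : Fin n => (α • b + β • x) i.succ) =
        α • (fun i : Fin n => b i.succ) + β • fun i : Fin n => x i.succ := by
      ext i
      simp
    rw [this]
    refine (norm_add_le _ _).trans (le_of_eq ?_)
    rw [norm_smul, norm_smul, Real.norm_of_nonneg hα, Real.norm_of_nonneg hβ]
  -- a convex combination of two positive gaps is positive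
  have hcomb : ∀ p q : ℝ, 0 < p → 0 < q → 0 < α * p + β * q := by
    intro p q hp hq
    rcases hα.eq_or_lt with h | h
    · have : β = 1 := by linarith
      rw [← h, this]
      linarith
    · have := mul_pos h hp
      have := mul_nonneg hβ hq.le
      linarith
  refine ⟨habs.trans_lt ?_, htail.trans_lt ?_⟩
  · have := hcomb (1 - |b 0|) (1 - |x 0|) (by linarith) (by linarith)
    linarith
  · set R := Real.exp (-(κ * |x 0|)) with hR
    have hR0 : 0 < R := Real.exp_pos _
    have hRκ : Real.exp (-κ) ≤ R := by
      rw [hR, Real.exp_le_exp, neg_le_neg_iff]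
      exact mul_le_of_le_one_right hκ hx0.le
    have hprof : R * (1 - α / 2) ≤ Real.exp (-(κ * |(α • b + β • x) 0|)) := by
      have h1 : |(α • b + β • x) 0| ≤ α * ρ + |x 0| := by
        have h2 := mul_le_mul_of_nonneg_left hb0.le hα
        have h3 := mul_le_of_le_one_left (abs_nonneg (x 0)) (by linarith : β ≤ 1)
        linarith
      calc R * (1 - α / 2) ≤ R * (1 - α * (κ * ρ)) := by
            have := mul_le_mul_of_nonneg_left hρκ hα
            gcongr
            linarith
        _ ≤ R * Real.exp (-(α * (κ * ρ))) := by
            gcongr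
            exact Real.one_sub_le_exp_neg _
        _ = Real.exp (-(κ * (α * ρ + |x 0|))) := by
            rw [hR, ← Real.exp_add]
            congr 1
            ring
        _ ≤ _ := by gcongr
    have hgap : ρ ≤ ε * R / 2 := by
      have := mul_le_mul_of_nonneg_left hRκ hε.le
      linarith
    have h4 := hcomb (ε * R / 2 - ‖fun i : Fin n => b i.succ‖)
      (ε * R - ‖fun i : Fin n => x i.succ‖) (by linarith) (by linarith)
    have h5 := mul_le_mul_of_nonneg_left hprof hε.le
    have h6 : ε * (R * (1 - α / 2)) = α * (ε * R / 2) + β * (ε * R) := by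
      rw [show β = 1 - α by linarith]
      ring
    linarith

theorem spindle_mem_boundedLipschitzDomains (n : ℕ) {ε κ : ℝ} (hε : 0 < ε) (hκ : 0 ≤ κ) :
    spindle n 1 ε κ ∈ boundedLipschitzDomains (n + 1) := by
  set ρ := min 1 (min (1 / 2 / (κ + 1)) (ε * Real.exp (-κ) / 2)) with hρ
  have hρ0 : 0 < ρ := by positivity
  have hρκ : κ * ρ ≤ 1 / 2 := by
    have h1 : ρ ≤ 1 / 2 / (κ + 1) := (min_le_right _ _).trans (min_le_left _ _)
    rw [le_div_iff₀ (by positivity)] at h1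
    linarith
  have hstar : ∀ b ∈ Metric.ball 0 ρ, StarConvex ℝ b (spindle n 1 ε κ) := fun b hb =>
    starConvex_spindle n hε hκ (min_le_left _ _) hρκ
      ((min_le_right _ _).trans (min_le_right _ _)) hb
  have h0 : (0 : EuclideanSpace ℝ (Fin (n + 1))) ∈ spindle n 1 ε κ := by
    refine ⟨by simp, ?_⟩
    have : (fun i : Fin n => (0 : EuclideanSpace ℝ (Fin (n + 1))) i.succ) = 0 := by ext i; simp
    rw [this, norm_zero]
    positivity
  refine ⟨isOpen_spindle n 1 ε κ, ?_, isBounded_spindle n hε hκ,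
    hasLipschitzBoundary_of_starConvex (isOpen_spindle n 1 ε κ) hρ0 hstar⟩
  exact ((hstar 0 (Metric.mem_ball_self hρ0)).isPathConnected h0).isConnected

theorem one_le_diam_spindle (n : ℕ) {ε κ : ℝ} (hε : 0 < ε) (hκ : 0 ≤ κ) :
    1 ≤ Metric.diam (spindle n 1 ε κ) := by
  have hmem : ∀ t : ℝ, |t| < 1 → EuclideanSpace.single 0 t ∈ spindle n 1 ε κ := by
    intro t ht
    refine ⟨by simpa using ht, ?_⟩
    have : (fun i : Fin n => (EuclideanSpace.single (0 : Fin (n + 1)) t) i.succ) = 0 := by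
      ext i
      simp
    rw [this, norm_zero]
    positivity
  have h := Metric.dist_le_diam_of_mem (isBounded_spindle n hε hκ)
    (hmem (1 / 2) (by norm_num [abs_of_pos])) (hmem (-1 / 2) (by norm_num [abs_of_pos, abs_div]))
  rw [PiLp.dist_single_same, Real.dist_eq] at h
  norm_num at h
  exact h

/-- The identification of `ℝ × ℝⁿ` with `ℝⁿ⁺¹`. -/
noncomputable def consCLM (n : ℕ) : (ℝ × (Fin n → ℝ)) →L[ℝ] EuclideanSpace ℝ (Fin (n + 1)) :=
  ((EuclideanSpace.equiv (Fin (n + 1)) ℝ).symm : (Fin (n + 1) → ℝ) →L[ℝ] _) ∘L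
    (Fin.consEquivL ℝ (fun _ : Fin (n + 1) => ℝ) : (ℝ × (Fin n → ℝ)) →L[ℝ] (Fin (n + 1) → ℝ))

@[simp] theorem consCLM_zero {n : ℕ} (p : ℝ × (Fin n → ℝ)) : consCLM n p 0 = p.1 := rfl

@[simp] theorem consCLM_succ {n : ℕ} (p : ℝ × (Fin n → ℝ)) (i : Fin n) :
    consCLM n p i.succ = p.2 i := rfl

theorem measurePreserving_consCLM (n : ℕ) : MeasurePreserving (consCLM n) := by
  have h := (EuclideanSpace.volume_preserving_symm_measurableEquiv_toLp (Fin (n + 1))).symm.comp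
    (volume_preserving_piFinSuccAbove (fun _ : Fin (n + 1) => ℝ) 0).symm
  convert! h using 1
  ext p i
  refine Fin.cases ?_ (fun i => ?_) i
  · simp
  · simp

theorem consCLM_mem_spindle {n : ℕ} {L ε κ : ℝ} {p : ℝ × (Fin n → ℝ)} :
    consCLM n p ∈ spindle n L ε κ ↔ |p.1| < L ∧ ‖p.2‖ < ε * Real.exp (-(κ * |p.1|)) := Iff.rfl

/-- The parametrization of the spindle by a segment times the unit cube. -/
noncomputable def spindleParam (n : ℕ) (ε κ : ℝ) (p : ℝ × (Fin n → ℝ)) :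
    EuclideanSpace ℝ (Fin (n + 1)) :=
  consCLM n (p.1, (ε * Real.exp (-(κ * |p.1|))) • p.2)

/-- The measure `exp (-α |t|) dt` on `(-L, L)`. -/
noncomputable def expMeasure (α L : ℝ) : Measure ℝ :=
  (volume.restrict (Ioo (-L) L)).withDensity fun t => ENNReal.ofReal (Real.exp (-(α * |t|)))

theorem lintegral_expMeasure {α L : ℝ} {F : ℝ → ℝ≥0∞} (hF : Measurable F) :
    ∫⁻ t, F t ∂(expMeasure α L) =
      ∫⁻ t in Ioo (-L) L, F t * ENNReal.ofReal (Real.exp (-(α * |t|))) := by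
  rw [expMeasure, lintegral_withDensity_eq_lintegral_mul _ (by fun_prop) hF]
  simp only [Pi.mul_apply, mul_comm]

theorem continuous_spindleParam (n : ℕ) (ε κ : ℝ) : Continuous (spindleParam n ε κ) := by
  unfold spindleParam
  fun_prop

theorem setLIntegral_ball_zero {n : ℕ} {R : ℝ} (hR : 0 < R) {F : (Fin n → ℝ) → ℝ≥0∞}
    (hF : Measurable F) :
    ∫⁻ y in Metric.ball 0 R, F y =
      ENNReal.ofReal (R ^ n) * ∫⁻ y in Metric.ball 0 1, F (R • y) := by
  have h := lintegral_comp_smul_add volume hR 0 (hF.indicator (measurableSet_ball (x := 0) (ε := R)))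
  rw [lintegral_indicator measurableSet_ball, Module.finrank_fin_fun] at h
  have e : ∀ y : Fin n → ℝ, (Metric.ball 0 R).indicator F (R • y + 0) =
      (Metric.ball 0 1).indicator (fun y => F (R • y)) y := by
    intro y
    have : R • y ∈ Metric.ball (0 : Fin n → ℝ) R ↔ y ∈ Metric.ball (0 : Fin n → ℝ) 1 := by
      rw [mem_ball_zero_iff, mem_ball_zero_iff, norm_smul, Real.norm_of_nonneg hR.le,
        mul_lt_iff_lt_one_right hR]
    rw [add_zero]
    by_cases hy : y ∈ Metric.ball (0 : Fin n → ℝ) 1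
    · rw [indicator_of_mem hy, indicator_of_mem (this.2 hy)]
    · rw [indicator_of_notMem hy, indicator_of_notMem (mt this.1 hy)]
  simp only [e] at h
  rw [lintegral_indicator measurableSet_ball] at h
  rw [h, ← mul_assoc, ← ENNReal.ofReal_mul (by positivity), mul_inv_cancel₀ (by positivity),
    ENNReal.ofReal_one, one_mul]

/-- Lebesgue measure on the spindle is the product of a measure with exponential density on the
segment and Lebesgue measure on the unit cube. -/
theorem setLIntegral_spindle {n : ℕ} {L ε κ : ℝ} (hε : 0 < ε)
    {F : EuclideanSpace ℝ (Fin (n + 1)) → ℝ≥0∞} (hF : Measurable F) :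
    ∫⁻ x in spindle n L ε κ, F x = ENNReal.ofReal (ε ^ n) *
      ∫⁻ p, F (spindleParam n ε κ p)
        ∂((expMeasure (n * κ) L).prod (volume.restrict (Metric.ball 0 1))) := by
  have hS : MeasurableSet (spindle n L ε κ) := (isOpen_spindle n L ε κ).measurableSet
  have hQ : Measurable (consCLM n) := (consCLM n).continuous.measurable
  have hFP : Measurable fun p => F (spindleParam n ε κ p) :=
    hF.comp (continuous_spindleParam n ε κ).measurable
  have hslice : ∀ t, ∫⁻ y, (spindle n L ε κ).indicator F (consCLM n (t, y)) =
      (Ioo (-L) L).indicator (fun t => ENNReal.ofReal (ε ^ n) *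
        ((∫⁻ y in Metric.ball 0 1, F (spindleParam n ε κ (t, y))) *
          ENNReal.ofReal (Real.exp (-(n * κ * |t|))))) t := by
    intro t
    have hR : 0 < ε * Real.exp (-(κ * |t|)) := by positivity
    by_cases ht : t ∈ Ioo (-L) L
    · have e : ∀ y : Fin n → ℝ, (spindle n L ε κ).indicator F (consCLM n (t, y)) =
          (Metric.ball 0 (ε * Real.exp (-(κ * |t|)))).indicator
            (fun y => F (consCLM n (t, y))) y := by
        intro y
        by_cases hy : ‖y‖ < ε * Real.exp (-(κ * |t|))
        · rw [indicator_of_mem (consCLM_mem_spindle.2 ⟨abs_lt.2 ⟨ht.1, ht.2⟩, hy⟩),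
            indicator_of_mem (mem_ball_zero_iff.2 hy)]
        · rw [indicator_of_notMem (fun h => hy (consCLM_mem_spindle.1 h).2),
            indicator_of_notMem (fun h => hy (mem_ball_zero_iff.1 h))]
      rw [indicator_of_mem ht, lintegral_congr e, lintegral_indicator measurableSet_ball,
        setLIntegral_ball_zero hR (by fun_prop), mul_pow, ← Real.exp_nat_mul,
        ENNReal.ofReal_mul (by positivity), mul_assoc, mul_comm (ENNReal.ofReal (Real.exp _)),
        mul_neg, ← mul_assoc (n : ℝ)]
      rfl
    · rw [indicator_of_notMem ht]
      have e : ∀ y : Fin n → ℝ, (spindle n L ε κ).indicator F (consCLM n (t, y)) = 0 := fun y =>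
        indicator_of_notMem (fun h => ht (abs_lt.1 (consCLM_mem_spindle.1 h).1)) _
      simp [e]
  have hm : Measurable fun t => ∫⁻ y in Metric.ball 0 1, F (spindleParam n ε κ (t, y)) :=
    hFP.lintegral_prod_right'
  rw [← lintegral_indicator hS, ← (measurePreserving_consCLM n).lintegral_comp (hF.indicator hS),
    Measure.volume_eq_prod, lintegral_prod _ (by exact ((hF.indicator hS).comp hQ).aemeasurable),
    lintegral_congr hslice, lintegral_indicator measurableSet_Ioo,
    lintegral_const_mul _ (by fun_prop), lintegral_prod _ hFP.aemeasurable,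
    lintegral_expMeasure hm]

/-! ### The Poincaré inequality on spindles -/

theorem isFiniteMeasure_expMeasure {α L : ℝ} (hα : 0 ≤ α) : IsFiniteMeasure (expMeasure α L) := by
  constructor
  have h := lintegral_expMeasure (α := α) (L := L) (F := fun _ => 1) measurable_const
  rw [lintegral_const, one_mul] at h
  rw [h]
  refine lt_of_le_of_lt (b := volume (Ioo (-L) L)) ?_ (by simp)
  rw [← setLIntegral_one]
  refine lintegral_mono fun t => ?_
  rw [one_mul, ← ENNReal.ofReal_one]
  exact ENNReal.ofReal_le_ofReal (Real.exp_le_one_iff.2 (neg_nonpos.2 (by positivity)))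

instance (α L : ℝ) : SFinite (expMeasure α L) := by
  unfold expMeasure
  infer_instance

/-- Along the curves `t ↦ (t, ε exp (-κ |t|) y)` the derivative of `f` is bounded by its gradient,
as long as `ε κ ≤ 1`. -/
theorem enorm_deriv_comp_spindleParam_le {n : ℕ} {ε κ : ℝ} (hε : 0 < ε) (hκ : 0 ≤ κ)
    (hεκ : ε * κ ≤ 1) {f : EuclideanSpace ℝ (Fin (n + 1)) → ℝ} (hf : Differentiable ℝ f)
    {y : Fin n → ℝ} (hy : y ∈ Metric.ball 0 1) {t : ℝ} (ht : t ≠ 0) :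
    DifferentiableAt ℝ (fun t => f (spindleParam n ε κ (t, y))) t ∧
    ‖deriv (fun t => f (spindleParam n ε κ (t, y))) t‖ₑ ≤
      ‖consCLM n‖ₑ * ‖fderiv ℝ f (spindleParam n ε κ (t, y))‖ₑ := by
  set s : ℝ := (SignType.sign t : ℝ) with hs
  have h1 : HasDerivAt (fun t => -(κ * |t|)) (-(κ * s)) t := ((hasDerivAt_abs ht).const_mul κ).neg
  have h2 : HasDerivAt (fun t => ε * Real.exp (-(κ * |t|)))
      (ε * (Real.exp (-(κ * |t|)) * -(κ * s))) t := h1.exp.const_mul ε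
  have h3 : HasDerivAt (fun t => (t, (ε * Real.exp (-(κ * |t|))) • y))
      ((1 : ℝ), (ε * (Real.exp (-(κ * |t|)) * -(κ * s))) • y) t :=
    (hasDerivAt_id t).prodMk (h2.smul_const y)
  have h4 : HasDerivAt (fun t => spindleParam n ε κ (t, y)) (consCLM n
      ((1 : ℝ), (ε * (Real.exp (-(κ * |t|)) * -(κ * s))) • y)) t :=
    (consCLM n).hasFDerivAt.comp_hasDerivAt t h3
  have h5 := (hf (spindleParam n ε κ (t, y))).hasFDerivAt.comp_hasDerivAt t h4
  refine ⟨h5.differentiableAt, ?_⟩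
  have h6 : deriv (fun t => f (spindleParam n ε κ (t, y))) t = _ := h5.deriv
  rw [h6]
  have hs1 : |s| ≤ 1 := by
    rcases lt_or_gt_of_ne ht with h | h
    · simp [hs, sign_neg h]
    · simp [hs, sign_pos h]
  have hn : ‖((1 : ℝ), (ε * (Real.exp (-(κ * |t|)) * -(κ * s))) • y)‖ₑ ≤ 1 := by
    rw [← ofReal_norm, ← ENNReal.ofReal_one]
    refine ENNReal.ofReal_le_ofReal (max_le (by simp) ?_)
    have hexp : Real.exp (-(κ * |t|)) ≤ 1 := Real.exp_le_one_iff.2 (neg_nonpos.2 (by positivity))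
    have hy1 : ‖y‖ ≤ 1 := (mem_ball_zero_iff.1 hy).le
    simp only [norm_smul, norm_mul, norm_neg, Real.norm_eq_abs, abs_of_pos hε, Real.abs_exp,
      abs_of_nonneg hκ]
    calc ε * (Real.exp (-(κ * |t|)) * (κ * |s|)) * ‖y‖
        ≤ ε * (1 * (κ * 1)) * 1 := by gcongr
      _ ≤ 1 := by linarith
  calc ‖fderiv ℝ f (spindleParam n ε κ (t, y)) (consCLM n
        ((1 : ℝ), (ε * (Real.exp (-(κ * |t|)) * -(κ * s))) • y))‖ₑ
      ≤ ‖fderiv ℝ f (spindleParam n ε κ (t, y))‖ₑ * (‖consCLM n‖ₑ * 1) :=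
        (ContinuousLinearMap.le_opENorm _ _).trans
          (by gcongr; exact (ContinuousLinearMap.le_opENorm _ _).trans (by gcongr))
    _ = _ := by rw [mul_one, mul_comm]

theorem lintegral_lintegral_spindle_axis_le {n : ℕ} {L ε κ α : ℝ} (hε : 0 < ε)
    (hκ : 0 ≤ κ) (hα : 0 < α) (hεκ : ε * κ ≤ 1) {f : EuclideanSpace ℝ (Fin (n + 1)) → ℝ}
    (hf : ContDiff ℝ 1 f) {y : Fin n → ℝ} (hy : y ∈ Metric.ball 0 1) :
    ∫⁻ t, ∫⁻ t', ‖f (spindleParam n ε κ (t, y)) - f (spindleParam n ε κ (t', y))‖ₑ ^ 2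
        ∂(expMeasure α L) ∂(expMeasure α L) ≤
      2 * expMeasure α L univ * (ENNReal.ofReal (4 / α ^ 2) * ‖consCLM n‖ₑ ^ 2) *
        ∫⁻ t, ‖fderiv ℝ f (spindleParam n ε κ (t, y))‖ₑ ^ 2 ∂(expMeasure α L) := by
  have hfin := isFiniteMeasure_expMeasure (L := L) hα.le
  have hΨ : Continuous fun t => spindleParam n ε κ (t, y) :=
    (continuous_spindleParam n ε κ).comp (by fun_prop)
  have hv : Continuous fun t => f (spindleParam n ε κ (t, y)) := hf.continuous.comp hΨ
  have hfd : Continuous fun t => ‖fderiv ℝ f (spindleParam n ε κ (t, y))‖ₑ :=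
    ((hf.continuous_fderiv one_ne_zero).comp hΨ).enorm
  have hdiff := hf.differentiable one_ne_zero
  have hmem : MemLp (fun t => f (spindleParam n ε κ (t, y))) 2 (expMeasure α L) := by
    obtain ⟨B, hB⟩ := isCompact_Icc (a := -L) (b := L) |>.exists_bound_of_continuousOn
      hv.continuousOn
    refine MemLp.of_bound hv.aestronglyMeasurable B ?_
    refine (withDensity_absolutelyContinuous _ _).ae_le ?_
    exact (ae_restrict_mem measurableSet_Ioo).mono fun x hx => hB x (Ioo_subset_Icc_self hx)
  refine (lintegral_lintegral_enorm_sub_sq_le hmem (f (spindleParam n ε κ (0, y)))).trans ?_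
  have hmv : Measurable fun t =>
      ‖f (spindleParam n ε κ (t, y)) - f (spindleParam n ε κ (0, y))‖ₑ ^ 2 :=
    (hv.sub continuous_const).enorm.measurable.pow_const 2
  have hG : Measurable fun t => ‖consCLM n‖ₑ * ‖fderiv ℝ f (spindleParam n ε κ (t, y))‖ₑ :=
    measurable_const.mul hfd.measurable
  have hardy := lintegral_sq_mul_exp_le (L := L) hα (v := fun t =>
      ‖f (spindleParam n ε κ (t, y)) - f (spindleParam n ε κ (0, y))‖ₑ) hG (fun t _ => by
    refine (enorm_sub_le_lintegral_enorm_deriv (countable_singleton 0) hv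
      (fun x hx => (enorm_deriv_comp_spindleParam_le hε hκ hεκ hdiff hy hx).1.hasDerivAt)
      (measurable_deriv _) 0 t).trans (lintegral_mono_ae ?_)
    have hne : ∀ᵐ s : ℝ, s ≠ 0 := by simp [ae_iff, measure_singleton]
    filter_upwards [ae_restrict_of_ae hne] with s hs
    exact (enorm_deriv_comp_spindleParam_le hε hκ hεκ hdiff hy hs).2)
  rw [← lintegral_expMeasure hmv, ← lintegral_expMeasure (hG.pow_const 2)] at hardy
  simp only [mul_pow] at hardy
  rw [lintegral_const_mul _ (hfd.measurable.pow_const 2)] at hardy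
  rw [mul_assoc (2 * expMeasure α L univ), mul_assoc (ENNReal.ofReal _)]
  gcongr

theorem lintegral_lintegral_spindle_section_le {n : ℕ} {ε κ : ℝ} (hε : 0 < ε)
    (hκ : 0 ≤ κ) {f : EuclideanSpace ℝ (Fin (n + 1)) → ℝ} (hf : ContDiff ℝ 1 f) (t : ℝ) :
    ∫⁻ y in Metric.ball 0 1, ∫⁻ y' in Metric.ball 0 1,
        ‖f (spindleParam n ε κ (t, y)) - f (spindleParam n ε κ (t, y'))‖ₑ ^ 2 ≤
      4 * 2 ^ n * volume (Metric.ball (0 : Fin n → ℝ) 1) *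
        (ENNReal.ofReal (ε ^ 2) * ‖consCLM n‖ₑ ^ 2) *
        ∫⁻ y in Metric.ball 0 1, ‖fderiv ℝ f (spindleParam n ε κ (t, y))‖ₑ ^ 2 := by
  have hdiff := hf.differentiable one_ne_zero
  set r := ε * Real.exp (-(κ * |t|)) with hr
  have hr0 : 0 ≤ r := by positivity
  have hrε : r ≤ ε := mul_le_of_le_one_right hε.le
    (Real.exp_le_one_iff.2 (neg_nonpos.2 (by positivity)))
  have hsm : ContDiff ℝ 1 fun y : Fin n → ℝ => (t, r • y) :=
    contDiff_const.prodMk (contDiff_id.const_smul r)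
  have hlin : ContDiff ℝ 1 fun y : Fin n → ℝ => spindleParam n ε κ (t, y) :=
    (consCLM n).contDiff.comp hsm
  have hg : ContDiff ℝ 1 fun y : Fin n → ℝ => f (spindleParam n ε κ (t, y)) := hf.comp hlin
  have hfd : ∀ y : Fin n → ℝ, ‖fderiv ℝ (fun y => f (spindleParam n ε κ (t, y))) y‖ₑ ^ 2 ≤
      (ENNReal.ofReal (ε ^ 2) * ‖consCLM n‖ₑ ^ 2) *
        ‖fderiv ℝ f (spindleParam n ε κ (t, y))‖ₑ ^ 2 := by
    intro y
    have h1 : HasFDerivAt (fun y : Fin n → ℝ => r • y) (r • ContinuousLinearMap.id ℝ _) y :=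
      (hasFDerivAt_id y).const_smul r
    have h2 := (hasFDerivAt_const t y).prodMk h1
    have h3 := (hdiff (spindleParam n ε κ (t, y))).hasFDerivAt.comp y
      ((consCLM n).hasFDerivAt.comp y h2)
    have h4 : fderiv ℝ (fun y => f (spindleParam n ε κ (t, y))) y = _ := h3.fderiv
    have hle : ‖fderiv ℝ (fun y => f (spindleParam n ε κ (t, y))) y‖ ≤
        ε * ‖consCLM n‖ * ‖fderiv ℝ f (spindleParam n ε κ (t, y))‖ := by
      refine ContinuousLinearMap.opNorm_le_bound _ (by positivity) fun v => ?_
      rw [h4]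
      calc ‖fderiv ℝ f (spindleParam n ε κ (t, y)) (consCLM n ((0 : ℝ), r • v))‖
          ≤ ‖fderiv ℝ f (spindleParam n ε κ (t, y))‖ * (‖consCLM n‖ * (ε * ‖v‖)) := by
            refine (ContinuousLinearMap.le_opNorm _ _).trans ?_
            gcongr
            refine (ContinuousLinearMap.le_opNorm _ _).trans ?_
            gcongr
            refine max_le (by simp; positivity) ?_
            rw [norm_smul, Real.norm_of_nonneg hr0]
            gcongr
        _ = _ := by ring
    rw [← ofReal_norm, ← ofReal_norm, ← ofReal_norm, ← ENNReal.ofReal_pow (norm_nonneg _),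
      ← ENNReal.ofReal_pow (norm_nonneg _), ← ENNReal.ofReal_pow (norm_nonneg _),
      ← ENNReal.ofReal_mul (by positivity), ← ENNReal.ofReal_mul (by positivity),
      ← mul_pow, ← mul_pow]
    exact ENNReal.ofReal_le_ofReal (by gcongr)
  have hP := Convex.lintegral_lintegral_sub_sq_le (volume : Measure (Fin n → ℝ))
    measurableSet_ball (convex_ball (0 : Fin n → ℝ) 1) (fun x hx y hy => by
      have h1 := mem_ball_zero_iff.1 hx
      have h2 := mem_ball_zero_iff.1 hy
      linarith [norm_sub_le y x]) hg
  rw [Module.finrank_fin_fun] at hP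
  have hm : Measurable fun y : Fin n → ℝ => ‖fderiv ℝ f (spindleParam n ε κ (t, y))‖ₑ ^ 2 :=
    ((hf.continuous_fderiv one_ne_zero).comp hlin.continuous).enorm.measurable.pow_const 2
  refine hP.trans ?_
  rw [mul_assoc _ (ENNReal.ofReal (ε ^ 2) * _), ← lintegral_const_mul _ hm]
  gcongr with y
  exact hfd y

/-- The Poincaré inequality on a spindle: Hardy's inequality along the curves following the profile
and the Poincaré inequality on the cross sections. -/
theorem lintegral_lintegral_spindle_le {n : ℕ} (hn : 1 ≤ n) {L ε κ : ℝ} (hε : 0 < ε)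
    (hκ : 0 < κ) (hεκ : ε * κ ≤ 1) {f : EuclideanSpace ℝ (Fin (n + 1)) → ℝ}
    (hf : ContDiff ℝ 1 f) :
    ∫⁻ x in spindle n L ε κ, ∫⁻ y in spindle n L ε κ, ‖f x - f y‖ₑ ^ 2 ≤
      volume (spindle n L ε κ) *
        (2 * (2 * (ENNReal.ofReal (4 / (n * κ) ^ 2) * ‖consCLM n‖ₑ ^ 2)) +
          2 * (4 * 2 ^ n * (ENNReal.ofReal (ε ^ 2) * ‖consCLM n‖ₑ ^ 2))) *
        ∫⁻ x in spindle n L ε κ, ‖fderiv ℝ f x‖ₑ ^ 2 := by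
  have hα : 0 < (n : ℝ) * κ := mul_pos (by exact_mod_cast hn) hκ
  set ν₁ := expMeasure (n * κ) L with hν₁
  set ν₂ : Measure (Fin n → ℝ) := volume.restrict (Metric.ball 0 1) with hν₂
  set c := ENNReal.ofReal (ε ^ n) with hc
  have hΨ := continuous_spindleParam n ε κ
  have hfm : Measurable f := hf.continuous.measurable
  have hH : Measurable fun x => ‖fderiv ℝ f x‖ₑ ^ 2 :=
    (hf.continuous_fderiv one_ne_zero).enorm.measurable.pow_const 2
  have hHΨ : Measurable fun p => ‖fderiv ℝ f (spindleParam n ε κ p)‖ₑ ^ 2 := hH.comp hΨ.measurable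
  have hgm : Measurable fun p => f (spindleParam n ε κ p) := hfm.comp hΨ.measurable
  have hvol : volume (spindle n L ε κ) = c * (ν₁ univ * ν₂ univ) := by
    rw [← setLIntegral_one, setLIntegral_spindle hε measurable_const, lintegral_one,
      ← univ_prod_univ, Measure.prod_prod]
  have hen : ∫⁻ x in spindle n L ε κ, ‖fderiv ℝ f x‖ₑ ^ 2 =
      c * ∫⁻ p, ‖fderiv ℝ f (spindleParam n ε κ p)‖ₑ ^ 2 ∂(ν₁.prod ν₂) :=
    setLIntegral_spindle hε hH
  have hinner : ∀ x, ∫⁻ y in spindle n L ε κ, ‖f x - f y‖ₑ ^ 2 =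
      c * ∫⁻ q, ‖f x - f (spindleParam n ε κ q)‖ₑ ^ 2 ∂(ν₁.prod ν₂) := fun x =>
    setLIntegral_spindle hε (by fun_prop)
  have hm1 : Measurable fun z : EuclideanSpace ℝ (Fin (n + 1)) × (ℝ × (Fin n → ℝ)) =>
      ‖f z.1 - f (spindleParam n ε κ z.2)‖ₑ ^ 2 := by fun_prop
  have hm2 : Measurable fun x =>
      ∫⁻ q, ‖f x - f (spindleParam n ε κ q)‖ₑ ^ 2 ∂(ν₁.prod ν₂) := hm1.lintegral_prod_right'
  have hlhs : ∫⁻ x in spindle n L ε κ, ∫⁻ y in spindle n L ε κ, ‖f x - f y‖ₑ ^ 2 =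
      c * (c * ∫⁻ p, ∫⁻ q, ‖f (spindleParam n ε κ p) - f (spindleParam n ε κ q)‖ₑ ^ 2
        ∂(ν₁.prod ν₂) ∂(ν₁.prod ν₂)) := by
    rw [lintegral_congr hinner, lintegral_const_mul _ hm2, setLIntegral_spindle hε hm2]
  set Q := ‖consCLM n‖ₑ ^ 2 with hQ
  set T := ∫⁻ p, ‖fderiv ℝ f (spindleParam n ε κ p)‖ₑ ^ 2 ∂(ν₁.prod ν₂) with hT
  have hhor : ∫⁻ y, ∫⁻ t, ∫⁻ t',
      ‖f (spindleParam n ε κ (t, y)) - f (spindleParam n ε κ (t', y))‖ₑ ^ 2 ∂ν₁ ∂ν₁ ∂ν₂ ≤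
      2 * ν₁ univ * (ENNReal.ofReal (4 / (n * κ) ^ 2) * Q) * T := by
    rw [hT, lintegral_prod_symm' _ hHΨ, ← lintegral_const_mul _ hHΨ.lintegral_prod_left']
    exact setLIntegral_mono' measurableSet_ball fun y hy =>
      lintegral_lintegral_spindle_axis_le hε hκ.le hα hεκ hf hy
  have hver : ∫⁻ t, ∫⁻ y, ∫⁻ y',
      ‖f (spindleParam n ε κ (t, y)) - f (spindleParam n ε κ (t, y'))‖ₑ ^ 2 ∂ν₂ ∂ν₂ ∂ν₁ ≤
      4 * 2 ^ n * ν₂ univ * (ENNReal.ofReal (ε ^ 2) * Q) * T := by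
    rw [hT, lintegral_prod _ hHΨ.aemeasurable, ← lintegral_const_mul _ hHΨ.lintegral_prod_right',
      hν₂, Measure.restrict_apply_univ]
    exact lintegral_mono fun t => lintegral_lintegral_spindle_section_le hε hκ.le hf t
  have htensor := lintegral_lintegral_prod_enorm_sub_sq_le ν₁ ν₂ hgm
  rw [hlhs, hvol, hen]
  calc c * (c * ∫⁻ p, ∫⁻ q, ‖f (spindleParam n ε κ p) - f (spindleParam n ε κ q)‖ₑ ^ 2
        ∂(ν₁.prod ν₂) ∂(ν₁.prod ν₂))
      ≤ c * (c * (2 * ν₂ univ * (2 * ν₁ univ * (ENNReal.ofReal (4 / (n * κ) ^ 2) * Q) * T) +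
          2 * ν₁ univ * (4 * 2 ^ n * ν₂ univ * (ENNReal.ofReal (ε ^ 2) * Q) * T))) := by
        gcongr
        refine htensor.trans ?_
        gcongr
    _ = _ := by ring

/-! ### Neumann eigenvalues of spindles -/

theorem zero_mem_spindle (n : ℕ) {L ε : ℝ} (κ : ℝ) (hL : 0 < L) (hε : 0 < ε) :
    0 ∈ spindle n L ε κ := by
  refine ⟨by simpa using hL, ?_⟩
  have : (fun i : Fin n => (0 : EuclideanSpace ℝ (Fin (n + 1))) i.succ) = 0 := by ext i; simp
  rw [this, norm_zero]
  positivity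

theorem closure_spindle_subset {n : ℕ} {L L' ε ε' κ : ℝ} (hL : L < L') (hε : ε < ε') :
    closure (spindle n L ε κ) ⊆ spindle n L' ε' κ := by
  have h1 : Continuous fun x : EuclideanSpace ℝ (Fin (n + 1)) => |x 0| := by fun_prop
  have h2 : Continuous fun x : EuclideanSpace ℝ (Fin (n + 1)) => ‖fun i : Fin n => x i.succ‖ := by
    fun_prop
  have h3 : Continuous fun x : EuclideanSpace ℝ (Fin (n + 1)) =>
      ε * Real.exp (-(κ * |x 0|)) := by fun_prop
  have hcl : closure (spindle n L ε κ) ⊆ {x | |x 0| ≤ L} ∩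
      {x | ‖fun i : Fin n => x i.succ‖ ≤ ε * Real.exp (-(κ * |x 0|))} :=
    closure_minimal (fun x hx => ⟨hx.1.le, hx.2.le⟩)
      ((isClosed_le h1 continuous_const).inter (isClosed_le h2 h3))
  exact fun x hx => ⟨(hcl hx).1.trans_lt hL, (hcl hx).2.trans_lt (by gcongr)⟩

/-- The Neumann eigenvalue of the spindle of profile `κ⁻¹ exp (-κ |t|)` grows quadratically
in `κ`. -/
theorem ofReal_le_neumannEigenvalue_spindle {n : ℕ} (hn : 1 ≤ n) {κ : ℝ} (hκ : 0 < κ) :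
    ENNReal.ofReal (κ ^ 2 / ((‖consCLM n‖ + 1) ^ 2 * (8 + 2 ^ (n + 2)))) ≤
      neumannEigenvalue 1 (spindle n 1 κ⁻¹ κ) := by
  set q := ‖consCLM n‖ with hq
  have hq0 : 0 ≤ q := norm_nonneg _
  set A := (q + 1) ^ 2 * (8 + 2 ^ (n + 2)) with hA
  have hA0 : 0 < A := by positivity
  have hε : 0 < κ⁻¹ := inv_pos.2 hκ
  -- the spindle is exhausted by the slightly shorter and thinner spindles with factor `θ j < 1`
  set θ : ℕ → ℝ := fun j => 1 - 1 / ((j : ℝ) + 2) with hθ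
  have hθ1 : ∀ j, θ j < 1 := fun j => sub_lt_self _ (by positivity)
  have hθ0 : ∀ j, 0 < θ j := by
    intro j
    rw [hθ, sub_pos, div_lt_one (by positivity)]
    have : (0 : ℝ) ≤ j := j.cast_nonneg
    linarith
  have hθlim : Tendsto θ atTop (𝓝 1) := by
    have h : Tendsto (fun j : ℕ => 1 / (((j + 1 : ℕ) : ℝ) + 1)) atTop (𝓝 0) :=
      tendsto_one_div_add_atTop_nhds_zero_nat.comp (tendsto_add_atTop_nat 1)
    have h2 := (tendsto_const_nhds (x := (1 : ℝ))).sub h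
    rw [sub_zero] at h2
    refine h2.congr fun j => ?_
    rw [hθ]
    push_cast
    ring
  have hθε : ∀ j, θ j * κ⁻¹ < κ⁻¹ := fun j => mul_lt_of_lt_one_left hε (hθ1 j)
  have hclos : ∀ j, closure (spindle n (θ j) (θ j * κ⁻¹) κ) ⊆ spindle n 1 κ⁻¹ κ := fun j =>
    closure_spindle_subset (hθ1 j) (hθε j)
  have hev : ∀ x ∈ spindle n 1 κ⁻¹ κ, ∀ᶠ j in atTop, x ∈ spindle n (θ j) (θ j * κ⁻¹) κ := by
    intro x hx
    have hlim : Tendsto (fun j => θ j * κ⁻¹ * Real.exp (-(κ * |x 0|))) atTop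
        (𝓝 (1 * κ⁻¹ * Real.exp (-(κ * |x 0|)))) := (hθlim.mul_const _).mul_const _
    rw [one_mul] at hlim
    filter_upwards [hθlim.eventually (lt_mem_nhds hx.1), hlim.eventually (lt_mem_nhds hx.2)]
      with j h1 h2 using ⟨h1, h2⟩
  have hmain := inv_le_minMaxValue_one (isOpen_spindle n 1 κ⁻¹ κ)
    ⟨0, zero_mem_spindle n κ one_pos hε⟩ (isBounded_spindle n hε hκ.le)
    (h := fun _ => (1 : ℝ)) (M := 0) (B := 1) le_rfl measurable_const (fun _ => one_pos)
    (fun x y => by simp) (fun _ _ => le_rfl)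
    (K := fun j => spindle n (θ j) (θ j * κ⁻¹) κ)
    (fun j => (isOpen_spindle n _ _ κ).measurableSet) hclos hev
    (C := ENNReal.ofReal (A / κ ^ 2)) (fun j f hf => by
      rw [weightMeasure_one]
      refine (lintegral_lintegral_spindle_le hn (mul_pos (hθ0 j) hε) hκ
        (((mul_lt_mul_of_pos_right (hθε j) hκ).trans_eq (inv_mul_cancel₀ hκ.ne')).le)
        (hf.of_le (by exact_mod_cast le_top))).trans ?_
      have hvol : volume (spindle n (θ j) (θ j * κ⁻¹) κ) ≤ volume (spindle n 1 κ⁻¹ κ) :=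
        measure_mono (subset_closure.trans (hclos j))
      gcongr ?_ * _
      rw [mul_comm 2 (volume (spindle n 1 κ⁻¹ κ)), mul_assoc (volume _)]
      gcongr ?_ * ?_
      have hQ : ‖consCLM n‖ₑ ^ 2 ≤ ENNReal.ofReal ((q + 1) ^ 2) := by
        rw [← ofReal_norm, ← ENNReal.ofReal_pow hq0]
        exact ENNReal.ofReal_le_ofReal (by gcongr; linarith)
      have h1 : ENNReal.ofReal (4 / (n * κ) ^ 2) ≤ ENNReal.ofReal (4 / κ ^ 2) := by
        refine ENNReal.ofReal_le_ofReal ?_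
        gcongr
        exact le_mul_of_one_le_left hκ.le (by exact_mod_cast hn)
      have h2 : ENNReal.ofReal ((θ j * κ⁻¹) ^ 2) ≤ ENNReal.ofReal (1 / κ ^ 2) := by
        refine ENNReal.ofReal_le_ofReal ?_
        rw [one_div, ← inv_pow]
        have := hθ0 j
        gcongr
        exact (hθε j).le
      have e2 : (2 : ℝ≥0∞) = ENNReal.ofReal 2 := by simp
      have e4 : (4 : ℝ≥0∞) = ENNReal.ofReal 4 := by simp
      calc 2 * (2 * (ENNReal.ofReal (4 / (n * κ) ^ 2) * ‖consCLM n‖ₑ ^ 2)) +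
            2 * (4 * 2 ^ n * (ENNReal.ofReal ((θ j * κ⁻¹) ^ 2) * ‖consCLM n‖ₑ ^ 2))
          ≤ 2 * (2 * (ENNReal.ofReal (4 / κ ^ 2) * ENNReal.ofReal ((q + 1) ^ 2))) +
            2 * (4 * 2 ^ n * (ENNReal.ofReal (1 / κ ^ 2) * ENNReal.ofReal ((q + 1) ^ 2))) := by
            gcongr
        _ = ENNReal.ofReal (2 * (2 * (4 / κ ^ 2 * (q + 1) ^ 2)) +
            2 * (4 * 2 ^ n * (1 / κ ^ 2 * (q + 1) ^ 2))) := by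
            rw [e2, e4, ← ENNReal.ofReal_pow (by positivity)]
            simp only [← ENNReal.ofReal_mul (show (0 : ℝ) ≤ 2 by norm_num),
              ← ENNReal.ofReal_mul (show (0 : ℝ) ≤ 4 / κ ^ 2 by positivity),
              ← ENNReal.ofReal_mul (show (0 : ℝ) ≤ 4 by norm_num),
              ← ENNReal.ofReal_mul (show (0 : ℝ) ≤ 4 * 2 ^ n by positivity),
              ← ENNReal.ofReal_mul (show (0 : ℝ) ≤ 1 / κ ^ 2 by positivity)]
            rw [ENNReal.ofReal_add (by positivity) (by positivity)]
        _ = 2 * ENNReal.ofReal (A / κ ^ 2) := by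
            rw [e2, ← ENNReal.ofReal_mul (by positivity)]
            congr 1
            rw [hA]
            ring)
  rw [← inv_div, ENNReal.ofReal_inv_of_pos (by positivity)]
  exact hmain

theorem iSup_diam_sq_mul_neumannEigenvalue {d : ℕ} (hd : 2 ≤ d) :
    (⨆ Ω ∈ boundedLipschitzDomains d,
      ENNReal.ofReal (Metric.diam Ω) ^ 2 * neumannEigenvalue 1 Ω) = ⊤ := by
  obtain ⟨n, rfl⟩ : ∃ n, d = n + 1 := ⟨d - 1, by omega⟩
  refine ENNReal.eq_top_of_forall_nnreal_le fun M => ?_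
  set A := (‖consCLM n‖ + 1) ^ 2 * (8 + 2 ^ (n + 2)) with hA
  have hA0 : 0 < A := by positivity
  set κ : ℝ := A * M + 1 with hκ
  have hκ1 : 1 ≤ κ := by
    have : 0 ≤ A * M := by positivity
    linarith
  have hκ0 : 0 < κ := by linarith
  have hε : 0 < κ⁻¹ := inv_pos.2 hκ0
  refine le_trans ?_ (le_iSup₂ (f := fun Ω (_ : Ω ∈ boundedLipschitzDomains (n + 1)) =>
    ENNReal.ofReal (Metric.diam Ω) ^ 2 * neumannEigenvalue 1 Ω) (spindle n 1 κ⁻¹ κ)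
    (spindle_mem_boundedLipschitzDomains n hε hκ0.le))
  have h1 : 1 ≤ ENNReal.ofReal (Metric.diam (spindle n 1 κ⁻¹ κ)) ^ 2 :=
    one_le_pow₀ (by simpa using one_le_diam_spindle n hε hκ0.le)
  refine le_trans ?_ (mul_le_mul' h1 (ofReal_le_neumannEigenvalue_spindle (by omega) hκ0))
  rw [one_mul, ← ENNReal.ofReal_coe_nnreal]
  refine ENNReal.ofReal_le_ofReal ?_
  rw [← hA, le_div_iff₀ hA0]
  nlinarith

theorem mainTheorem8 :
    (∀ a : ℝ, 0 < a → a < 1 / 2 →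
      IsLeast (plateauRoots a) (plateauRoot a) ∧
      relaxedEigenvalue 1 (plateauWeight a) = ENNReal.ofReal (plateauRoot a ^ 2)) ∧
    Tendsto plateauRoot (𝓝[<] (1 / 2 : ℝ)) atTop ∧
    Tendsto (fun a : ℝ => relaxedEigenvalue 1 (plateauWeight a)) (𝓝[<] (1 / 2 : ℝ)) (𝓝 ⊤) ∧
    ∀ d : ℕ, 2 ≤ d →
      (⨆ Ω ∈ boundedLipschitzDomains d,
        ENNReal.ofReal (Metric.diam Ω) ^ 2 * neumannEigenvalue 1 Ω) = ⊤ :=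
  ⟨fun _ ha ha2 => ⟨(isLeast_plateauRoots ha ha2).1, relaxedEigenvalue_plateauWeight ha ha2⟩,
    tendsto_plateauRoot, tendsto_relaxedEigenvalue_plateauWeight,
    fun _ hd => iSup_diam_sq_mul_neumannEigenvalue hd⟩
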